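/- All logarithms are to the base $2$. Let $\mathcal X,\mathcal Y$ be finite sets and let $W_0,W_1$ be two discrete memoryless channels from $\mathcal X$ to $\mathcal Y$. For a distribution $P$ on $\mathcal X$ and a channel $W$ put $PW(y)=\sum_x P(x)W(y|x)$ and $$I(P,W)=\sum_x P(x)\,D\big(W(\cdot|x)\,\big\|\,PW\big),\qquad V(P,W)=\sum_xP(x)\sum_y W(y|x)\Big[\log\tfrac{W(y|x)}{PW(y)}-D\big(W(\cdot|x)\,\big\|\,PW\big)\Big]^2 ,$$ where $D$ is the relative entropy. Let $C(W)=\max_P I(P,W)$ and call $P$ a capacity-achieving input distribution (CAID) of $W$ if $I(P,W)=C(W)$. Let $\varepsilon\in(0,1)$; the $\varepsilon$-dispersion of $W$ is the minimum of $V(P,W)$ over the CAIDs $P$ of $W$ if $\varepsilon<\frac12$, and the maximum if $\varepsilon\ge\frac12$. If the CAID $P$ of $W$ is unique, the $\varepsilon$-dispersion is $V(P,W)$ for every $\varepsilon$ and is denoted by $V(W)$. Let $P_S$ be a distribution on $\{0,1\}$ and $\pi_s=P_S(s)$. The mixed channel of blocklength $n$ is $$W^{(n)}_{\mathrm{mix}}(\mathbf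 y|\mathbf x)=\sum_{s\in\{0,1\}}\pi_s\prod_{i=1}^nW_s(y_i|x_i).$$ Let $M^*_n$ be the largest $M$ for which there are an encoder $f:\{1,\dots,M\}\to\mathcal X^n$ and a decoder $\varphi:\mathcal Y^n\to\{1,\dots,M\}$ with average error probability $\frac1M\sum_{m=1}^M W^{(n)}_{\mathrm{mix}}(\{\mathbf y:\varphi(\mathbf y)\ne m\}\,|\,f(m))\le\varepsilon$, and let $C_\varepsilon=\liminf_{n\to\infty}\frac1n\log M^*_n$ be the $\varepsilon$-capacity. For $C\in\mathbb R$ we say that $L\in[-\infty,\infty]$ is the second-order coding rate with first-order coefficient $C$ if $\lim_{n\to\infty}(\log M_n^*-nC)/\sqrt n=L$; for finite $L$ this means $\log M^*_n=nC+\sqrt n\,L+o(\sqrt n)$. Let $\Phi$ be the standard Gaussian cumulative distribution function and $\Phi^{-1}(p)=\sup\{y\in\mathbb R:\Phi(y)\le p\}\in[-\infty,\infty]$. **Theorem.** Assume that $W_0$ and $W_1$ each have a unique CAID, that the two CAIDs coincide, and that $V(W_0)>0$ and $V(W_1)>0$. * Case (i): $C(W_0)=C(W_1)$. Then $C_\varepsilon=C(W_0)=C(W_1)$,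 the equation $$\pi_0\,\Phi\Big(\frac{l}{\sqrt{V(W_0)}}\Big)+\pi_1\,\Phi\Big(\frac{l}{\sqrt{V(W_1)}}\Big)=\varepsilon$$ has exactly one solution $l\in\mathbb R$, and the second-order coding rate with first-order coefficient $C(W_0)$ is $L=l$. * Case (ii): $C(W_0)<C(W_1)$ and $\varepsilon<\pi_0$. Then $C_\varepsilon=C(W_0)$, and the second-order coding rate with first-order coefficient $C(W_0)$ is $L=\sqrt{V(W_0)}\,\Phi^{-1}(\varepsilon/\pi_0)$. * Case (iii): $C(W_0)<C(W_1)$ and $\varepsilon\ge\pi_0$. Then the second-order coding rate with first-order coefficient $C(W_1)$ is $L=\sqrt{V(W_1)}\,\Phi^{-1}\big((\varepsilon-\pi_0)/\pi_1\big)$; in particular $L=-\infty$ if $\varepsilon=\pi_0$. If $\varepsilon>\pi_0$, then moreover $C_\varepsilon=C(W_1)$. -/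

import Mathlib

open Filter Topology ProbabilityTheory

noncomputable section

namespace MixedChannel

/-! All logarithms are to the base `2`. -/

/-- The Gaussian cumulative distribution function `Φ`. -/
def gaussianCdf (y : ℝ) : ℝ := cdf (gaussianReal 0 1) y

/-- `Φ⁻¹(p) = sup {y ∈ ℝ : Φ(y) ≤ p}`, with values in the extended reals
(`-∞` for `p ≤ 0`, `+∞` for `p ≥ 1`, the usual inverse for `0 < p < 1`). -/
def gaussianCdfInv (p : ℝ) : EReal :=
  sSup ((fun y : ℝ => (y : EReal)) '' {y : ℝ | gaussianCdf y ≤ p})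

/-- A channel from a set `X` to a finite alphabet `Y`: for each input letter, a probability mass
function on `Y`. -/
abbrev Channel (X Y : Type*) [Fintype Y] := X → stdSimplex ℝ Y

section Codes

variable {X Y : Type*} [Fintype Y]

/-- The average error probability of a code with `M` messages, encoder `f` and decoder `φ`. -/
def avgError (W : Channel X Y) {M : ℕ} (f : Fin M → X) (φ : Y → Fin M) : ℝ :=
  (1 / (M : ℝ)) * ∑ m : Fin M, ∑ y : Y with φ y ≠ m, W (f m) y

/-- There is a code with `M ≥ 1` messages whose average error probability is at most `ε`. -/
def HasAvgCode (W : Channel X Y) (M : ℕ) (ε : ℝ) : Prop :=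
  1 ≤ M ∧ ∃ (f : Fin M → X) (φ : Y → Fin M), avgError W f φ ≤ ε

/-- The maximum size of a code for `W` with average error probability at most `ε`. For `X`
nonempty and `0 ≤ ε < 1` the supremum is a maximum. -/
def maxCodeSize (W : Channel X Y) (ε : ℝ) : ℕ := sSup {M : ℕ | HasAvgCode W M ε}

end Codes

section Information

variable {X Y : Type*} [Fintype X] [Fintype Y]

/-- The output distribution `PW(y) = ∑ x, P(x) W(y|x)`. -/
def outputDist (P : stdSimplex ℝ X) (W : Channel X Y) (y : Y) : ℝ := ∑ x, P x * W x y

/-- The relative entropy `D(p ‖ q)`. It is used below only weighted by `P(x)`, for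
`p = W(·|x)` and `q = PW`; then `p ≪ q` whenever the weight is nonzero. -/
def relEntropy (p q : Y → ℝ) : ℝ := ∑ y, p y * Real.logb 2 (p y / q y)

/-- The divergence variance `V(p ‖ q)`, the variance of `log (p/q)` under `p`. -/
def divVariance (p q : Y → ℝ) : ℝ :=
  ∑ y, p y * (Real.logb 2 (p y / q y) - relEntropy p q) ^ 2

/-- The mutual information `I(P, W) = D(W ‖ PW | P)`. -/
def mutualInfo (P : stdSimplex ℝ X) (W : Channel X Y) : ℝ :=
  ∑ x, P x * relEntropy (W x) (outputDist P W)

/-- The conditional information variance `V(P, W) = V(W ‖ PW | P)`. -/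
def condInfoVariance (P : stdSimplex ℝ X) (W : Channel X Y) : ℝ :=
  ∑ x, P x * divVariance (W x) (outputDist P W)

/-- The capacity `C(W) = max_P I(P, W)`. -/
def capacity (W : Channel X Y) : ℝ := ⨆ P : stdSimplex ℝ X, mutualInfo P W

/-- The set `Π(W)` of capacity-achieving input distributions (CAIDs). -/
def caids (W : Channel X Y) : Set (stdSimplex ℝ X) := {P | mutualInfo P W = capacity W}

/-- The `ε`-channel dispersion: the minimum of `V(P, W)` over the CAIDs `P` if `ε < 1/2`, and the
maximum if `ε ≥ 1/2`. -/
def dispersion (W : Channel X Y) (ε : ℝ) : ℝ :=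
  if ε < 1 / 2 then sInf ((fun P => condInfoVariance P W) '' caids W)
  else sSup ((fun P => condInfoVariance P W) '' caids W)

/-- If the CAID is unique, the dispersion does not depend on `ε`. -/
theorem dispersion_eq_of_unique {W : Channel X Y} {P : stdSimplex ℝ X} (h : caids W = {P})
    (ε : ℝ) : dispersion W ε = condInfoVariance P W := by
  simp [dispersion, h]

end Information

section Mixed

variable {X Y : Type*} [Fintype Y]

/-- The mixed channel of blocklength `n`: the state `s` is drawn once from `PS` and the memoryless
channel `W s` is then used `n` times,
`W_mix(y|x) = ∑ s, PS(s) ∏ i, W s (y i | x i)`. -/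
def mixedChannel (W : Fin 2 → Channel X Y) (PS : stdSimplex ℝ (Fin 2)) (n : ℕ) :
    Channel (Fin n → X) (Fin n → Y) := fun x =>
  ⟨fun y => ∑ s, PS s * ∏ i, W s (x i) (y i), by
    classical
    constructor
    · intro y
      exact Finset.sum_nonneg fun s _ =>
        mul_nonneg (PS.2.1 s) (Finset.prod_nonneg fun i _ => (W s (x i)).2.1 (y i))
    · rw [Finset.sum_comm]
      have h : ∀ s, ∑ y : Fin n → Y, ∏ i, W s (x i) (y i) = 1 := by
        intro s
        rw [← Fintype.prod_sum (fun i b => W s (x i) b)]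
        exact Finset.prod_eq_one fun i _ => (W s (x i)).2.2
      simp_rw [← Finset.mul_sum, h, mul_one]
      exact PS.2.2⟩

/-- `log M*`, the logarithm of the maximum number of messages that can be transmitted over `n` uses
of the mixed channel with average error probability at most `ε`. -/
def logMaxCodeSize (W : Fin 2 → Channel X Y) (PS : stdSimplex ℝ (Fin 2)) (ε : ℝ) (n : ℕ) : ℝ :=
  Real.logb 2 (maxCodeSize (mixedChannel W PS n) ε)

/-- The `ε`-capacity of the mixed channel, `liminf (1/n) log M*`. -/
def epsCapacity (W : Fin 2 → Channel X Y) (PS : stdSimplex ℝ (Fin 2)) (ε : ℝ) : ℝ :=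
  liminf (fun n : ℕ => (1 / (n : ℝ)) * logMaxCodeSize W PS ε n) atTop

/-- `log M* = n C + √n L + o(√n)` with first-order coefficient `C` and second-order coding rate
`L`. For `L = -∞` this says that `(log M* - n C) / √n` tends to `-∞`. -/
def HasSecondOrderRate (W : Fin 2 → Channel X Y) (PS : stdSimplex ℝ (Fin 2)) (ε C : ℝ)
    (L : EReal) : Prop :=
  Tendsto (fun n : ℕ => (((logMaxCodeSize W PS ε n - n * C) / √(n : ℝ) : ℝ) : EReal)) atTop (𝓝 L)

end Mixed

end MixedChannel

end

namespace MixedChannel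

open MeasureTheory

/-! ### Probabilities of events under finitely supported weights -/

/-! In state s, the log-likelihood ratio of a word against the product of the output law `P W_s`,
for inputs drawn from the common CAID P, has mean nC(W_s) and variance nV(W_s). It stays below nC +
a√n with limiting probability `stateLimit`: 1, Φ(a/√V(W_s)) or 0 according as C(W_s) is below, equal
to or above C. Let F(a) be the average of these limits over the state. Up to an arbitrarily small
change of a, codes with log M = nC + a√n exist when F(a) < ε and do not exist when F(a) > ε. So L is
the point where F crosses ε (`hasSecondOrderRate_of_forall_lt`), and the three cases only evaluate
F.

Achievability (`eventually_le_logMaxCodeSize`) is Feinstein's lemma for the mixed channel with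
i.i.d. inputs from P; a common CAID lets one input law serve both states. `sum_mul_prob_mixture_le`
passes from the likelihood ratio of the mixture to those of its components, and the input-output
pairs are i.i.d., so the central limit theorem gives F.

The converse (`eventually_logMaxCodeSize_le`) must handle codewords of every type t. A codeword of
type near t is tested against the output law of the midpoint r of P and t. For t = P this is the
capacity-achieving output, and the central limit theorem applies because every letter has divergence
at most C(W_s) from it. For t ≠ P, uniqueness of the CAID makes the mean divergence strictly smaller
than C(W_s), and Chebyshev's inequality gives probability tending to 1 when C = C(W_s). Compactness
of the simplex leaves finitely many output laws, which cost only a constant factor in the one-shot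
bound `sum_mul_le_avgError_add`. -/

open Classical in
/-- The total weight of the event `A` under the weights `μ` on a finite set. -/
noncomputable def prob {Ω : Type*} [Fintype Ω] (μ : Ω → ℝ) (A : Ω → Prop) : ℝ :=
  ∑ ω : Ω with A ω, μ ω

section Prob

variable {Ω : Type*} [Fintype Ω] {μ : Ω → ℝ} {A B : Ω → Prop}

theorem prob_eq_sum_filter (μ : Ω → ℝ) (A : Ω → Prop) [DecidablePred A] :
    prob μ A = ∑ ω : Ω with A ω, μ ω := by
  unfold prob; congr

open Classical in
theorem prob_eq_sum_ite (μ : Ω → ℝ) (A : Ω → Prop) :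
    prob μ A = ∑ ω, if A ω then μ ω else 0 := by
  rw [prob, Finset.sum_filter]

theorem prob_nonneg (hμ : ∀ ω, 0 ≤ μ ω) : 0 ≤ prob μ A :=
  Finset.sum_nonneg fun ω _ => hμ ω

theorem prob_mono_of_pos (hμ : ∀ ω, 0 ≤ μ ω) (h : ∀ ω, 0 < μ ω → A ω → B ω) :
    prob μ A ≤ prob μ B := by
  classical
  rw [prob_eq_sum_ite, prob_eq_sum_ite]
  refine Finset.sum_le_sum fun ω _ => ?_
  rcases (hμ ω).eq_or_lt with h0 | h0
  · simp [← h0]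
  · by_cases hA : A ω
    · simp [hA, h ω h0 hA]
    · simp only [hA, if_false]; split_ifs <;> simp [h0.le]

theorem prob_mono (hμ : ∀ ω, 0 ≤ μ ω) (h : ∀ ω, A ω → B ω) : prob μ A ≤ prob μ B :=
  prob_mono_of_pos hμ fun ω _ => h ω

theorem prob_add_prob_not : prob μ A + prob μ (fun ω => ¬ A ω) = ∑ ω, μ ω := by
  classical
  rw [prob_eq_sum_ite, prob_eq_sum_ite, ← Finset.sum_add_distrib]
  exact Finset.sum_congr rfl fun ω _ => by by_cases h : A ω <;> simp [h]

theorem prob_le_sum (hμ : ∀ ω, 0 ≤ μ ω) : prob μ A ≤ ∑ ω, μ ω := by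
  classical
  exact Finset.sum_le_sum_of_subset_of_nonneg (Finset.filter_subset _ _) fun ω _ _ => hμ ω

theorem prob_or_le (hμ : ∀ ω, 0 ≤ μ ω) :
    prob μ (fun ω => A ω ∨ B ω) ≤ prob μ A + prob μ B := by
  classical
  rw [prob_eq_sum_ite, prob_eq_sum_ite, prob_eq_sum_ite, ← Finset.sum_add_distrib]
  refine Finset.sum_le_sum fun ω _ => ?_
  have := hμ ω
  by_cases hA : A ω <;> by_cases hB : B ω <;> simp [hA, hB, this]

theorem prob_le_mul_of_le {ν : Ω → ℝ} {c : ℝ} (h : ∀ ω, A ω → μ ω ≤ c * ν ω) :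
    prob μ A ≤ c * prob ν A := by
  unfold prob
  rw [Finset.mul_sum]
  exact Finset.sum_le_sum fun ω hω => h ω (by simpa using hω)

/-- Markov's inequality. -/
theorem prob_le_div_of_le {T : ℝ} (hT : 0 < T) (hμ : ∀ ω, 0 ≤ μ ω) {g : Ω → ℝ}
    (hg : ∀ ω, 0 ≤ g ω) (h : ∀ ω, A ω → T ≤ g ω) : prob μ A ≤ (∑ ω, μ ω * g ω) / T := by
  classical
  rw [le_div_iff₀ hT, prob_eq_sum_ite, Finset.sum_mul]
  refine Finset.sum_le_sum fun ω _ => ?_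
  by_cases hA : A ω
  · simpa [hA] using mul_le_mul_of_nonneg_left (h ω hA) (hμ ω)
  · simpa [hA] using mul_nonneg (hμ ω) (hg ω)

end Prob

/-! ### Memoryless extensions -/

section Memoryless

variable {X Y : Type*} [Fintype Y]

/-- The transition probability `∏ i, W(y i | x i)` of `n` uses of a memoryless channel. -/
noncomputable def memoryless (W : Channel X Y) {n : ℕ} (x : Fin n → X) (y : Fin n → Y) : ℝ :=
  ∏ i, W (x i) (y i)

theorem memoryless_nonneg (W : Channel X Y) {n : ℕ} (x : Fin n → X) (y : Fin n → Y) :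
    0 ≤ memoryless W x y := Finset.prod_nonneg fun i _ => (W (x i)).2.1 (y i)

theorem sum_memoryless (W : Channel X Y) {n : ℕ} (x : Fin n → X) :
    ∑ y, memoryless W x y = 1 := by
  classical
  unfold memoryless
  rw [← Fintype.prod_sum (fun i b => W (x i) b)]
  exact Finset.prod_eq_one fun i _ => (W (x i)).2.2

theorem pos_of_memoryless_pos {W : Channel X Y} {n : ℕ} {x : Fin n → X} {y : Fin n → Y}
    (h : 0 < memoryless W x y) (i : Fin n) : 0 < W (x i) (y i) := by
  refine lt_of_le_of_ne ((W (x i)).2.1 (y i)) fun h0 => h.ne' ?_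
  exact Finset.prod_eq_zero (Finset.mem_univ i) h0.symm

/-- Independence of the output coordinates. The values lie in an ℝ-algebra so that the same identity
serves second moments (R = ℝ) and characteristic functions (R = ℂ). -/
theorem sum_memoryless_mul_prod {R : Type*} [CommSemiring R] [Algebra ℝ R] (W : Channel X Y)
    {n : ℕ} (x : Fin n → X) (g : Fin n → Y → R) :
    ∑ y, algebraMap ℝ R (memoryless W x y) * ∏ i, g i (y i) =
      ∏ i, ∑ b, algebraMap ℝ R (W (x i) b) * g i b := by
  classical
  rw [Fintype.prod_sum (fun i b => algebraMap ℝ R (W (x i) b) * g i b)]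
  refine Finset.sum_congr rfl fun y _ => ?_
  rw [memoryless, map_prod, Finset.prod_mul_distrib]

/-- The centred second moment of a sum of independent centred random variables. -/
theorem sum_memoryless_mul_sq (W : Channel X Y) (z : X → Y → ℝ)
    (hz : ∀ a, ∑ b, W a b * z a b = 0) {n : ℕ} (x : Fin n → X) :
    ∑ y, memoryless W x y * (∑ i, z (x i) (y i)) ^ 2 = ∑ i, ∑ b, W (x i) b * z (x i) b ^ 2 := by
  classical
  have key : ∀ i j : Fin n, ∑ y, memoryless W x y * (z (x i) (y i) * z (x j) (y j)) =
      if i = j then ∑ b, W (x i) b * z (x i) b ^ 2 else 0 := by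
    intro i j
    -- The two conditional factors write z_i z_j as a product over all coordinates; for i = j they
    -- meet in one coordinate and give the square.
    have h := sum_memoryless_mul_prod (R := ℝ) W x
      (fun k b => (if k = i then z (x k) b else 1) * (if k = j then z (x k) b else 1))
    simp only [Algebra.algebraMap_self, RingHom.id_apply, Finset.prod_mul_distrib,
      Finset.prod_ite_eq', Finset.mem_univ, if_true] at h
    rw [h]
    by_cases hij : i = j
    · subst hij
      rw [if_pos rfl, Finset.prod_eq_single i]
      · simp [pow_two]
      · intro k _ hk
        simp [hk]
      · simp
    · rw [if_neg hij]
      refine Finset.prod_eq_zero (Finset.mem_univ i) ?_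
      simpa [hij] using hz (x i)
  calc ∑ y, memoryless W x y * (∑ i, z (x i) (y i)) ^ 2
      = ∑ i, ∑ j, ∑ y, memoryless W x y * (z (x i) (y i) * z (x j) (y j)) := by
        simp_rw [pow_two, Finset.sum_mul_sum, Finset.mul_sum]
        rw [Finset.sum_comm]
        exact Finset.sum_congr rfl fun i _ => Finset.sum_comm
    _ = _ := by simp_rw [key]; simp

/-- Chebyshev's inequality for sums of independent centred random variables. -/
theorem prob_memoryless_le_of_le_sum (W : Channel X Y) (z : X → Y → ℝ)
    (hz : ∀ a, ∑ b, W a b * z a b = 0) {K : ℝ} (hK : ∀ a, ∑ b, W a b * z a b ^ 2 ≤ K)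
    {n : ℕ} (x : Fin n → X) {T : ℝ} (hT : 0 < T) {A : (Fin n → Y) → Prop}
    (hA : ∀ y, A y → T ≤ |∑ i, z (x i) (y i)|) :
    prob (memoryless W x) A ≤ n * K / T ^ 2 := by
  refine (prob_le_div_of_le (pow_pos hT 2) (memoryless_nonneg W x)
    (g := fun y => (∑ i, z (x i) (y i)) ^ 2) (fun y => sq_nonneg _) fun y hy => ?_).trans ?_
  · rw [← sq_abs (∑ i, _)]
    exact pow_le_pow_left₀ hT.le (hA y hy) 2
  · rw [sum_memoryless_mul_sq W z hz x]
    gcongr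
    refine (Finset.sum_le_sum fun i _ => hK (x i)).trans ?_
    simp

end Memoryless

/-! ### Types and the central limit theorem for memoryless channels -/

section CLT

variable {X Y : Type*} [Fintype Y]

open Classical in
/-- The type (empirical distribution) of a word. -/
noncomputable def wordType {n : ℕ} (x : Fin n → X) (a : X) : ℝ :=
  (Finset.univ.filter fun i => x i = a).card / (n : ℝ)

theorem sum_wordType [Fintype X] {n : ℕ} (x : Fin n → X) (F : X → ℝ) :
    ∑ i, F (x i) = n * ∑ a, wordType x a * F a := by
  classical
  rcases Nat.eq_zero_or_pos n with rfl | hn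
  · simp
  have hn' : (n : ℝ) ≠ 0 := by positivity
  rw [← Finset.sum_fiberwise Finset.univ x, Finset.mul_sum]
  refine Finset.sum_congr rfl fun a _ => ?_
  rw [Finset.sum_congr rfl (g := fun _ => F a) fun i hi => by rw [(Finset.mem_filter.1 hi).2]]
  rw [Finset.sum_const, nsmul_eq_mul, wordType]
  field_simp

theorem wordType_mem_stdSimplex [Fintype X] {n : ℕ} (hn : 0 < n) (x : Fin n → X) :
    wordType x ∈ stdSimplex ℝ X := by
  refine ⟨fun a => by unfold wordType; positivity, ?_⟩
  have h := sum_wordType x fun _ => 1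
  have hn' : (n : ℝ) ≠ 0 := by positivity
  simpa [hn'] using h

/-- The filter of words whose length tends to infinity and whose type tends to `t`. -/
noncomputable def typeFilter (t : X → ℝ) : Filter (Σ n : ℕ, Fin n → X) :=
  comap (fun p => p.1) atTop ⊓ comap (fun p => wordType p.2) (𝓝 t)

/-- This allows limits along the filter to be tested on sequences of words. -/
instance [Fintype X] (t : X → ℝ) : (typeFilter t).IsCountablyGenerated := by
  unfold typeFilter; infer_instance

theorem tendsto_length_typeFilter (t : X → ℝ) :
    Tendsto (fun p : Σ n : ℕ, Fin n → X => p.1) (typeFilter t) atTop :=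
  tendsto_comap.mono_left inf_le_left

theorem tendsto_wordType_typeFilter (t : X → ℝ) :
    Tendsto (fun p : Σ n : ℕ, Fin n → X => wordType p.2) (typeFilter t) (𝓝 t) :=
  tendsto_comap.mono_left inf_le_right

/-- Taylor expansion: the quadratic term contributes exactly c²/2, and the cubic remainder, of order
n^(-3/2), vanishes after multiplication by n. -/
theorem tendsto_nat_mul_exp_sub_one_sub (c : ℂ) :
    Tendsto (fun n : ℕ => (n : ℂ) * (Complex.exp (c / (√(n : ℝ) : ℝ)) - 1 - c / (√(n : ℝ) : ℝ)))
      atTop (𝓝 (c ^ 2 / 2)) := by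
  have hs : Tendsto (fun n : ℕ => √(n : ℝ)) atTop atTop :=
    Real.tendsto_sqrt_atTop.comp tendsto_natCast_atTop_atTop
  have hinv : Tendsto (fun n : ℕ => (((√(n : ℝ))⁻¹ : ℝ) : ℂ)) atTop (𝓝 0) := by
    simpa [Function.comp_def] using
      (Complex.continuous_ofReal.tendsto 0).comp (tendsto_inv_atTop_zero.comp hs)
  have hx : Tendsto (fun n : ℕ => c / ((√(n : ℝ) : ℝ) : ℂ)) atTop (𝓝 0) := by
    simpa [div_eq_mul_inv] using hinv.const_mul c
  have hO := (Complex.exp_sub_sum_range_isBigO_pow 3).comp_tendsto hx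
  have hO2 := (Asymptotics.isBigO_refl (fun n : ℕ => (n : ℂ)) atTop).mul hO
  have hz : Tendsto (fun n : ℕ => (n : ℂ) * ((fun x : ℂ => x ^ 3) ∘
      fun n : ℕ => c / ((√(n : ℝ) : ℝ) : ℂ)) n) atTop (𝓝 0) := by
    have : Tendsto (fun n : ℕ => c ^ 3 * (((√(n : ℝ))⁻¹ : ℝ) : ℂ)) atTop (𝓝 0) := by
      simpa using hinv.const_mul (c ^ 3)
    refine this.congr' ?_
    filter_upwards [eventually_gt_atTop 0] with n hn
    have h1 : ((√(n : ℝ) : ℝ) : ℂ) ≠ 0 := by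
      simpa using hn.ne'
    have h2 : (n : ℂ) = ((√(n : ℝ) : ℝ) : ℂ) ^ 2 := by
      rw [← Complex.ofReal_pow, Real.sq_sqrt (Nat.cast_nonneg n)]; simp
    simp only [Function.comp]
    rw [h2]
    push_cast
    field_simp
  have h0 := (hO2.trans_tendsto hz).add_const (c ^ 2 / 2)
  rw [zero_add] at h0
  refine h0.congr' ?_
  filter_upwards [eventually_gt_atTop 0] with n hn
  have h1 : ((√(n : ℝ) : ℝ) : ℂ) ≠ 0 := by
    simpa using hn.ne'
  have h2 : (n : ℂ) = ((√(n : ℝ) : ℝ) : ℂ) ^ 2 := by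
    rw [← Complex.ofReal_pow, Real.sq_sqrt (Nat.cast_nonneg n)]; simp
  simp only [Function.comp, Finset.sum_range_succ, Finset.sum_range_zero]
  rw [h2]
  norm_num [Nat.factorial]
  field_simp
  ring

/-- The characteristic function of one centred letter, scaled by `1 / √n`. -/
noncomputable def letterCharFun (w : stdSimplex ℝ Y) (z : Y → ℝ) (u : ℝ) (n : ℕ) : ℂ :=
  ∑ b, (w b : ℂ) * Complex.exp (u * z b * Complex.I / (√(n : ℝ) : ℝ))

theorem tendsto_nat_mul_letterCharFun_sub_one (w : stdSimplex ℝ Y) (z : Y → ℝ)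
    (hz : ∑ b, w b * z b = 0) (u : ℝ) :
    Tendsto (fun n : ℕ => (n : ℂ) * (letterCharFun w z u n - 1)) atTop
      (𝓝 (-((∑ b, w b * z b ^ 2 : ℝ) : ℂ) * u ^ 2 / 2)) := by
  have h : Tendsto (fun n : ℕ => ∑ b, (w b : ℂ) * ((n : ℂ) *
      (Complex.exp (u * z b * Complex.I / (√(n : ℝ) : ℝ)) - 1 -
        u * z b * Complex.I / (√(n : ℝ) : ℝ)))) atTop
      (𝓝 (∑ b, (w b : ℂ) * ((u * z b * Complex.I) ^ 2 / 2))) :=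
    tendsto_finsetSum _ fun b _ => (tendsto_nat_mul_exp_sub_one_sub _).const_mul _
  have hlim : ∑ b, (w b : ℂ) * ((u * z b * Complex.I) ^ 2 / 2) =
      -((∑ b, w b * z b ^ 2 : ℝ) : ℂ) * u ^ 2 / 2 := by
    push_cast
    rw [neg_mul, Finset.sum_mul, ← Finset.sum_neg_distrib, Finset.sum_div]
    refine Finset.sum_congr rfl fun b _ => ?_
    rw [mul_pow, Complex.I_sq]; ring
  rw [← hlim]
  refine h.congr fun n => ?_
  have h1 : ∑ b, (w b : ℂ) = 1 := by exact_mod_cast w.2.2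
  have h2 : ∑ b, (w b : ℂ) * z b = 0 := by exact_mod_cast hz
  have h3 : ∑ b, (w b : ℂ) * (u * z b * Complex.I / (√(n : ℝ) : ℝ)) = 0 := by
    calc _ = (u * Complex.I / (√(n : ℝ) : ℝ)) * ∑ b, (w b : ℂ) * z b := by
          rw [Finset.mul_sum]; exact Finset.sum_congr rfl fun b _ => by ring
      _ = 0 := by rw [h2, mul_zero]
  calc _ = (n : ℂ) * (letterCharFun w z u n - ∑ b, (w b : ℂ) -
        ∑ b, (w b : ℂ) * (u * z b * Complex.I / (√(n : ℝ) : ℝ))) := by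
        rw [letterCharFun, ← Finset.sum_sub_distrib, ← Finset.sum_sub_distrib, Finset.mul_sum]
        exact Finset.sum_congr rfl fun b _ => by ring
    _ = _ := by rw [h1, h3, sub_zero]

/-- The law of `(∑ i, z (x i) (y i)) / √n` under the memoryless channel with input word `x`. -/
noncomputable def sumLaw (W : Channel X Y) (z : X → Y → ℝ) {n : ℕ} (x : Fin n → X) :
    Measure ℝ :=
  ∑ y, ENNReal.ofReal (memoryless W x y) • Measure.dirac ((∑ i, z (x i) (y i)) / √(n : ℝ))

theorem isProbabilityMeasure_sumLaw (W : Channel X Y) (z : X → Y → ℝ) {n : ℕ} (x : Fin n → X) :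
    IsProbabilityMeasure (sumLaw W z x) := by
  refine ⟨?_⟩
  simp only [sumLaw, Measure.coe_finsetSum, Finset.sum_apply, Measure.smul_apply, measure_univ,
    smul_eq_mul, mul_one]
  rw [← ENNReal.ofReal_sum_of_nonneg fun y _ => memoryless_nonneg W x y, sum_memoryless]
  simp

theorem prob_sum_le_eq_sumLaw (W : Channel X Y) (z : X → Y → ℝ) {n : ℕ} (hn : 0 < n)
    (x : Fin n → X) (a : ℝ) :
    prob (memoryless W x) (fun y => ∑ i, z (x i) (y i) ≤ a * √(n : ℝ)) =
      (sumLaw W z x).real (Set.Iic a) := by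
  classical
  have hs : 0 < √(n : ℝ) := Real.sqrt_pos.2 (by exact_mod_cast hn)
  rw [prob_eq_sum_ite, Measure.real, sumLaw]
  simp only [Measure.coe_finsetSum, Finset.sum_apply, Measure.smul_apply, smul_eq_mul,
    Measure.dirac_apply' _ measurableSet_Iic]
  rw [ENNReal.toReal_sum fun y _ =>
    ENNReal.mul_ne_top ENNReal.ofReal_ne_top (by simp [Set.indicator]; split_ifs <;> simp)]
  refine Finset.sum_congr rfl fun y _ => ?_
  rw [ENNReal.toReal_mul, ENNReal.toReal_ofReal (memoryless_nonneg W x y)]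
  simp only [Set.indicator, Set.mem_Iic, div_le_iff₀ hs, Pi.one_apply]
  split_ifs <;> simp

theorem charFun_sumLaw (W : Channel X Y) (z : X → Y → ℝ) {n : ℕ} (x : Fin n → X) (u : ℝ) :
    charFun (sumLaw W z x) u = ∏ i, letterCharFun (W (x i)) (z (x i)) u n := by
  rw [charFun_apply, sumLaw, integral_finsetSum_measure fun y _ => ?_]
  · simp_rw [integral_smul_measure, integral_dirac]
    have h := sum_memoryless_mul_prod (R := ℂ) W x
      (fun i b => Complex.exp (u * z (x i) b * Complex.I / (√(n : ℝ) : ℝ)))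
    simp only [letterCharFun]
    simp only [Complex.coe_algebraMap] at h
    rw [← h]
    refine Finset.sum_congr rfl fun y _ => ?_
    rw [ENNReal.toReal_ofReal (memoryless_nonneg W x y), Complex.real_smul, ← Complex.exp_sum]
    congr 2
    simp only [RCLike.inner_apply, conj_trivial]
    push_cast
    rw [Finset.sum_div, Finset.mul_sum, Finset.sum_mul]
    exact Finset.sum_congr rfl fun i _ => by ring
  · refine Integrable.smul_measure ?_ ENNReal.ofReal_ne_top
    exact integrable_dirac (by simp)

theorem prod_comp_eq_prod_pow [Fintype X] {R : Type*} [CommMonoid R] {n : ℕ} (x : Fin n → X)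
    (F : X → R) [DecidableEq X] :
    ∏ i, F (x i) = ∏ a, F a ^ (Finset.univ.filter fun i => x i = a).card := by
  rw [← Finset.prod_fiberwise Finset.univ x]
  refine Finset.prod_congr rfl fun a _ => ?_
  rw [Finset.prod_congr rfl (g := fun _ => F a) fun i hi => by rw [(Finset.mem_filter.1 hi).2],
    Finset.prod_const]

/-- Grouping positions by input letter turns the characteristic function into a product of powers
with exponents n · type(a). In the exponential, each n · log of a letter factor tends to minus half
its variance times u², and the type supplies the weights. -/
theorem tendsto_charFun_sumLaw [Fintype X] (W : Channel X Y) (z : X → Y → ℝ)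
    (hz : ∀ a, ∑ b, W a b * z a b = 0) (t : X → ℝ) (u : ℝ) :
    Tendsto (fun p : Σ n : ℕ, Fin n → X => charFun (sumLaw W z p.2) u) (typeFilter t)
      (𝓝 (Complex.exp (-((∑ a, t a * ∑ b, W a b * z a b ^ 2 : ℝ) : ℂ) * u ^ 2 / 2))) := by
  classical
  have hlog : ∀ a, Tendsto (fun n : ℕ => (n : ℂ) * Complex.log (letterCharFun (W a) (z a) u n))
      atTop (𝓝 (-((∑ b, W a b * z a b ^ 2 : ℝ) : ℂ) * u ^ 2 / 2)) := fun a => by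
    simpa using Complex.tendsto_nat_mul_log_one_add_of_tendsto
      (tendsto_nat_mul_letterCharFun_sub_one (W a) (z a) (hz a) u)
  -- The letter factors tend to 1, so they are eventually nonzero and equal the exponential of their
  -- logarithm.
  have hne : ∀ a, ∀ᶠ n : ℕ in atTop, letterCharFun (W a) (z a) u n ≠ 0 := fun a => by
    have h1 := tendsto_nat_mul_letterCharFun_sub_one (W a) (z a) (hz a) u
    have h2 : Tendsto (fun n : ℕ => ((n : ℂ))⁻¹) atTop (𝓝 0) :=
      tendsto_inv_atTop_nhds_zero_nat (𝕜 := ℂ)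
    have h3 := (h2.mul h1).add_const 1
    rw [zero_mul, zero_add] at h3
    have h4 : Tendsto (fun n : ℕ => letterCharFun (W a) (z a) u n) atTop (𝓝 1) := by
      refine h3.congr' ?_
      filter_upwards [eventually_gt_atTop 0] with n hn
      have : (n : ℂ) ≠ 0 := by exact_mod_cast hn.ne'
      field_simp
      ring
    exact h4.eventually_ne one_ne_zero
  have hlen := tendsto_length_typeFilter t
  have hsum : Tendsto (fun p : Σ n : ℕ, Fin n → X => ∑ a, ((wordType p.2 a : ℝ) : ℂ) *
      ((p.1 : ℂ) * Complex.log (letterCharFun (W a) (z a) u p.1))) (typeFilter t)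
      (𝓝 (∑ a, ((t a : ℝ) : ℂ) * (-((∑ b, W a b * z a b ^ 2 : ℝ) : ℂ) * u ^ 2 / 2))) := by
    refine tendsto_finsetSum _ fun a _ => Tendsto.mul ?_ ((hlog a).comp hlen)
    exact (Complex.continuous_ofReal.tendsto _).comp
      ((tendsto_pi_nhds.1 (tendsto_wordType_typeFilter t)) a)
  have hlim : ∑ a, ((t a : ℝ) : ℂ) * (-((∑ b, W a b * z a b ^ 2 : ℝ) : ℂ) * u ^ 2 / 2) =
      -((∑ a, t a * ∑ b, W a b * z a b ^ 2 : ℝ) : ℂ) * u ^ 2 / 2 := by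
    rw [Complex.ofReal_sum, neg_mul, Finset.sum_mul, ← Finset.sum_neg_distrib, Finset.sum_div]
    refine Finset.sum_congr rfl fun a _ => ?_
    push_cast; ring
  rw [← hlim]
  refine ((Complex.continuous_exp.tendsto _).comp hsum).congr' ?_
  filter_upwards [hlen.eventually (eventually_all.2 hne), hlen.eventually (eventually_gt_atTop 0)]
    with p hp hp0
  rw [charFun_sumLaw, prod_comp_eq_prod_pow p.2 fun a => letterCharFun (W a) (z a) u p.1]
  simp only [Function.comp, Complex.exp_sum]
  refine Finset.prod_congr rfl fun a _ => ?_
  have h0 : (p.1 : ℂ) ≠ 0 := by exact_mod_cast hp0.ne'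
  conv_rhs => rw [← Complex.exp_log (hp a), ← Complex.exp_nat_mul]
  congr 1
  rw [wordType]
  push_cast
  field_simp

theorem gaussianReal_real_Iic {v : ℝ} (hv : 0 < v) (a : ℝ) :
    (gaussianReal 0 v.toNNReal).real (Set.Iic a) = gaussianCdf (a / √v) := by
  have hs : 0 < √v := Real.sqrt_pos.2 hv
  have h := gaussianReal_map_const_mul (μ := 0) (v := 1) (√v)
  have h2 : (NNReal.mk (√v ^ 2) (sq_nonneg _)) * 1 = v.toNNReal := by
    ext; simp [Real.sq_sqrt hv.le, hv.le]
  rw [mul_zero, h2] at h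
  rw [gaussianCdf, cdf_eq_real, ← h, map_measureReal_apply (by fun_prop) measurableSet_Iic]
  congr 1
  ext y
  simp [le_div_iff₀ hs, mul_comm]

/-- **Central limit theorem** for memoryless channels, along words whose type converges. -/
theorem tendsto_prob_sum_le [Fintype X] (W : Channel X Y) (z : X → Y → ℝ)
    (hz : ∀ a, ∑ b, W a b * z a b = 0) (t : X → ℝ) {v : ℝ}
    (hv : ∑ a, t a * ∑ b, W a b * z a b ^ 2 = v) (hv0 : 0 < v) (a : ℝ) :
    Tendsto (fun p : Σ n : ℕ, Fin n → X =>
      prob (memoryless W p.2) (fun y => ∑ i, z (p.2 i) (y i) ≤ a * √(p.1 : ℝ)))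
      (typeFilter t) (𝓝 (gaussianCdf (a / √v))) := by
  -- Along a sequence of words, convergence of characteristic functions gives weak convergence; the
  -- limit has no atoms, so half-lines are continuity sets.
  refine tendsto_of_seq_tendsto fun p hp => ?_
  let μ : ℕ → ProbabilityMeasure ℝ := fun k =>
    ⟨sumLaw W z (p k).2, isProbabilityMeasure_sumLaw W z _⟩
  let μ₀ : ProbabilityMeasure ℝ := ⟨gaussianReal 0 v.toNNReal, inferInstance⟩
  have hμ : Tendsto μ atTop (𝓝 μ₀) := by
    refine ProbabilityMeasure.tendsto_of_tendsto_charFun fun u => ?_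
    have h := (tendsto_charFun_sumLaw W z hz t u).comp hp
    have h2 : charFun (μ₀ : Measure ℝ) u = Complex.exp (-(v : ℂ) * u ^ 2 / 2) := by
      change charFun (gaussianReal 0 v.toNNReal) u = _
      rw [charFun_gaussianReal]
      congr 1
      simp [hv0.le]
      ring
    rw [h2, ← hv]
    exact h
  have : NullSingletonClass (μ₀ : Measure ℝ) :=
    nullSingletonClass_gaussianReal (by simpa using hv0)
  have hI := ProbabilityMeasure.tendsto_measure_of_null_frontier_of_tendsto' hμ
    (E := Set.Iic a) (by
      rw [frontier_Iic]
      exact measure_singleton a)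
  have hI2 := (ENNReal.tendsto_toReal (measure_ne_top _ _)).comp hI
  rw [← gaussianReal_real_Iic hv0]
  refine hI2.congr' ?_
  filter_upwards [((tendsto_length_typeFilter t).comp hp).eventually (eventually_gt_atTop 0)]
    with k hk
  exact (prob_sum_le_eq_sumLaw W z hk _ a).symm

end CLT
/-! ### Relative entropy and capacity-achieving input distributions -/

section Entropy

variable {X Y : Type*} [Fintype X] [Fintype Y]

/-- Gibbs' inequality. -/
theorem relEntropy_nonneg {Y : Type*} [Fintype Y] {p q : Y → ℝ} (hp : ∀ y, 0 ≤ p y)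
    (hq : ∀ y, 0 ≤ q y) (h : ∀ y, 0 < p y → 0 < q y) (hpq : ∑ y, q y ≤ ∑ y, p y) :
    0 ≤ relEntropy p q := by
  have hlog : 0 < Real.log 2 := Real.log_pos one_lt_two
  have key : ∀ y, (p y - q y) / Real.log 2 ≤ p y * Real.logb 2 (p y / q y) := by
    intro y
    rw [Real.logb, mul_div_assoc']
    refine div_le_div_of_nonneg_right ?_ hlog.le
    rcases (hp y).eq_or_lt with h0 | h0
    · simp [← h0, hq y]
    · have hq0 := h y h0
      have := Real.one_sub_inv_le_log_of_pos (div_pos h0 hq0)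
      calc p y - q y = p y * (1 - (p y / q y)⁻¹) := by field_simp
        _ ≤ _ := mul_le_mul_of_nonneg_left this h0.le
  calc 0 ≤ ∑ y, (p y - q y) / Real.log 2 := by
        rw [← Finset.sum_div, Finset.sum_sub_distrib]
        exact div_nonneg (sub_nonneg.2 hpq) hlog.le
    _ ≤ _ := Finset.sum_le_sum fun y _ => key y

theorem outputDist_nonneg (P : stdSimplex ℝ X) (W : Channel X Y) (y : Y) :
    0 ≤ outputDist P W y :=
  Finset.sum_nonneg fun x _ => mul_nonneg (P.2.1 x) ((W x).2.1 y)

theorem sum_outputDist (P : stdSimplex ℝ X) (W : Channel X Y) : ∑ y, outputDist P W y = 1 := by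
  unfold outputDist
  rw [Finset.sum_comm]
  simp_rw [← Finset.mul_sum]
  calc ∑ x, P x * ∑ y, W x y = ∑ x, P x := by
        refine Finset.sum_congr rfl fun x _ => ?_
        rw [show ∑ y, W x y = 1 from (W x).2.2, mul_one]
    _ = 1 := P.2.2

/-- The output distribution, as a point of the simplex. -/
noncomputable def outputPoint (P : stdSimplex ℝ X) (W : Channel X Y) : stdSimplex ℝ Y :=
  ⟨outputDist P W, outputDist_nonneg P W, sum_outputDist P W⟩

@[simp] theorem outputPoint_apply (P : stdSimplex ℝ X) (W : Channel X Y) (y : Y) :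
    outputPoint P W y = outputDist P W y := rfl

theorem outputDist_pos {P : stdSimplex ℝ X} {W : Channel X Y} {x : X} {y : Y} (hx : 0 < P x)
    (hy : 0 < W x y) : 0 < outputDist P W y :=
  (mul_pos hx hy).trans_le <| Finset.single_le_sum (f := fun x => P x * W x y)
    (fun x _ => mul_nonneg (P.2.1 x) ((W x).2.1 y)) (Finset.mem_univ x)

/-- The compensation identity: log(W/Q) = log(W/PW) + log(PW/Q) wherever P and W are positive, and
averaging the last term over inputs leaves a divergence of output laws. -/
theorem sum_mul_relEntropy (P : stdSimplex ℝ X) (W : Channel X Y) (Q : Y → ℝ)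
    (h : ∀ x y, 0 < P x → 0 < W x y → 0 < Q y) :
    ∑ x, P x * relEntropy (W x) Q = mutualInfo P W + relEntropy (outputDist P W) Q := by
  have h1 : relEntropy (outputDist P W) Q =
      ∑ x, P x * ∑ y, W x y * Real.logb 2 (outputDist P W y / Q y) := by
    unfold relEntropy
    simp_rw [Finset.mul_sum]
    rw [Finset.sum_comm]
    refine Finset.sum_congr rfl fun y _ => ?_
    conv_lhs => enter [1]; unfold outputDist
    rw [Finset.sum_mul]
    exact Finset.sum_congr rfl fun x _ => by ring
  rw [h1, mutualInfo, ← Finset.sum_add_distrib]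
  refine Finset.sum_congr rfl fun x _ => ?_
  rw [← mul_add]
  rcases (P.2.1 x).eq_or_lt with hx | hx
  · have : P x = 0 := hx.symm
    simp [this]
  congr 1
  unfold relEntropy
  rw [← Finset.sum_add_distrib]
  refine Finset.sum_congr rfl fun y _ => ?_
  rcases ((W x).2.1 y).eq_or_lt with hy | hy
  · have : W x y = 0 := hy.symm
    simp [this]
  have hW : W x y ≠ 0 := ne_of_gt hy
  have hQ := (h x y hx hy).ne'
  have hO := (outputDist_pos (P := P) hx hy).ne'
  rw [← mul_add, ← Real.logb_mul (div_ne_zero hW hO) (div_ne_zero hO hQ)]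
  congr 2
  field_simp

theorem exists_convexCombination (P t : stdSimplex ℝ X) {κ : ℝ} (h0 : 0 ≤ κ) (h1 : κ ≤ 1) :
    ∃ r : stdSimplex ℝ X, ∀ x, r x = (1 - κ) * P x + κ * t x :=
  ⟨⟨(1 - κ) • (P : X → ℝ) + κ • (t : X → ℝ),
    convex_stdSimplex ℝ X P.2 t.2 (sub_nonneg.2 h1) h0 (by ring)⟩, fun _ => rfl⟩

theorem outputDist_convexCombination {P t r : stdSimplex ℝ X} {κ : ℝ}
    (hr : ∀ x, r x = (1 - κ) * P x + κ * t x) (W : Channel X Y) (y : Y) :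
    outputDist r W y = (1 - κ) * outputDist P W y + κ * outputDist t W y := by
  unfold outputDist
  rw [Finset.mul_sum, Finset.mul_sum, ← Finset.sum_add_distrib]
  exact Finset.sum_congr rfl fun x _ => by rw [hr]; ring

theorem outputDist_le_one (P : stdSimplex ℝ X) (W : Channel X Y) (y : Y) :
    outputDist P W y ≤ 1 := by
  rw [← sum_outputDist P W]
  exact Finset.single_le_sum (fun y _ => outputDist_nonneg P W y) (Finset.mem_univ y)

/-- Compensation against the uniform output law. The bound is needed so that the real supremum
defining `capacity` really dominates every mutual information. -/
theorem mutualInfo_le_logb_card (P : stdSimplex ℝ X) (W : Channel X Y) :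
    mutualInfo P W ≤ Real.logb 2 (Fintype.card Y) := by
  obtain ⟨x₀⟩ : Nonempty X := by
    by_contra h
    rw [not_nonempty_iff] at h
    simpa using P.2.2
  have hY : Nonempty Y := by
    by_contra h
    rw [not_nonempty_iff] at h
    simpa using (W x₀).2.2
  have hc : 0 < (Fintype.card Y : ℝ) := by exact_mod_cast Fintype.card_pos
  have h := sum_mul_relEntropy P W (fun _ => (Fintype.card Y : ℝ)⁻¹) fun _ _ _ _ => inv_pos.2 hc
  have hn : 0 ≤ relEntropy (outputDist P W) fun _ => (Fintype.card Y : ℝ)⁻¹ := by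
    refine relEntropy_nonneg (outputDist_nonneg P W) (fun _ => (inv_pos.2 hc).le)
      (fun _ _ => inv_pos.2 hc) ?_
    rw [sum_outputDist]
    simp [hc.ne']
  have hx : ∀ x, relEntropy (W x) (fun _ => (Fintype.card Y : ℝ)⁻¹) ≤
      Real.logb 2 (Fintype.card Y) := by
    intro x
    calc _ ≤ ∑ y, W x y * Real.logb 2 (Fintype.card Y) := by
          refine Finset.sum_le_sum fun y _ => ?_
          rcases ((W x).2.1 y).eq_or_lt with hy | hy
          · have : W x y = 0 := hy.symm
            simp [this]
          · refine mul_le_mul_of_nonneg_left ?_ hy.le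
            refine Real.logb_le_logb_of_le one_lt_two (div_pos hy (inv_pos.2 hc)) ?_
            rw [div_inv_eq_mul]
            exact mul_le_of_le_one_left hc.le (stdSimplex.le_one (W x) y)
      _ = _ := by rw [← Finset.sum_mul, show ∑ y, W x y = 1 from (W x).2.2, one_mul]
  have : ∑ x, P x * relEntropy (W x) (fun _ => (Fintype.card Y : ℝ)⁻¹) ≤
      ∑ x, P x * Real.logb 2 (Fintype.card Y) :=
    Finset.sum_le_sum fun x _ => mul_le_mul_of_nonneg_left (hx x) (P.2.1 x)
  rw [← Finset.sum_mul, show ∑ x, P x = 1 from P.2.2, one_mul] at this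
  linarith

theorem mutualInfo_le_capacity (P : stdSimplex ℝ X) (W : Channel X Y) :
    mutualInfo P W ≤ capacity W :=
  le_ciSup (f := fun P : stdSimplex ℝ X => mutualInfo P W)
    ⟨_, by rintro _ ⟨Q, rfl⟩; exact mutualInfo_le_logb_card Q W⟩ P

/-- I(r, W) is the mixture, with weights 1 - κ and κ, of the P-average and the t-average of the
divergences from rW. By compensation and Gibbs' inequality the P-average is at least I(P, W). -/
theorem mul_sum_relEntropy_le {P t r : stdSimplex ℝ X} {κ : ℝ} (h0 : 0 < κ) (h1 : κ < 1)
    (hr : ∀ x, r x = (1 - κ) * P x + κ * t x) (W : Channel X Y) :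
    κ * ∑ x, t x * relEntropy (W x) (outputDist r W) ≤
      mutualInfo r W - (1 - κ) * mutualInfo P W := by
  have hpos : ∀ y, 0 < outputDist P W y → 0 < outputDist r W y := fun y hy => by
    rw [outputDist_convexCombination hr]
    have := outputDist_nonneg t W y
    have := mul_pos (sub_pos.2 h1) hy
    positivity
  have hI := sum_mul_relEntropy P W (outputDist r W) fun x y hx hy => hpos y (outputDist_pos hx hy)
  have hD : 0 ≤ relEntropy (outputDist P W) (outputDist r W) :=
    relEntropy_nonneg (outputDist_nonneg P W) (outputDist_nonneg r W) hpos
      (by rw [sum_outputDist, sum_outputDist])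
  have hsplit : mutualInfo r W = (1 - κ) * ∑ x, P x * relEntropy (W x) (outputDist r W) +
      κ * ∑ x, t x * relEntropy (W x) (outputDist r W) := by
    rw [mutualInfo, Finset.mul_sum, Finset.mul_sum, ← Finset.sum_add_distrib]
    exact Finset.sum_congr rfl fun x _ => by rw [hr]; ring
  have := mul_nonneg (sub_pos.2 h1).le hD
  rw [hsplit, hI]
  linarith

variable {P : stdSimplex ℝ X} {W : Channel X Y}

theorem sum_relEntropy_le_of_isMax (hP : ∀ Q, mutualInfo Q W ≤ mutualInfo P W)
    {t r : stdSimplex ℝ X} {κ : ℝ} (h0 : 0 < κ) (h1 : κ < 1)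
    (hr : ∀ x, r x = (1 - κ) * P x + κ * t x) :
    ∑ x, t x * relEntropy (W x) (outputDist r W) ≤ mutualInfo P W := by
  have h := mul_sum_relEntropy_le h0 h1 hr W
  have h2 := hP r
  have : κ * ∑ x, t x * relEntropy (W x) (outputDist r W) ≤ κ * mutualInfo P W := by linarith
  exact le_of_mul_le_mul_left this h0

/-- For t ≠ P the mixture r also differs from P, so uniqueness of the maximiser gives I(r, W) < I(P,
W). This strict gap disposes of codewords whose type is away from P. -/
theorem sum_relEntropy_lt_of_strictMax (hP : ∀ Q, Q ≠ P → mutualInfo Q W < mutualInfo P W)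
    {t r : stdSimplex ℝ X} (ht : t ≠ P) {κ : ℝ} (h0 : 0 < κ) (h1 : κ < 1)
    (hr : ∀ x, r x = (1 - κ) * P x + κ * t x) :
    ∑ x, t x * relEntropy (W x) (outputDist r W) < mutualInfo P W := by
  have h := mul_sum_relEntropy_le h0 h1 hr W
  have h2 := hP r fun hrP => ht <| DFunLike.ext _ _ fun x => by
    have := hr x
    rw [hrP] at this
    have h3 : κ * (t x - P x) = 0 := by linarith
    rcases mul_eq_zero.1 h3 with h4 | h4 <;> linarith
  have : κ * ∑ x, t x * relEntropy (W x) (outputDist r W) < κ * mutualInfo P W := by linarith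
  exact lt_of_mul_lt_mul_left this h0.le

theorem relEntropy_le_of_isMax_of_lt (hP : ∀ Q, mutualInfo Q W ≤ mutualInfo P W) (x : X)
    {κ : ℝ} (h0 : 0 < κ) (h1 : κ < 1) :
    relEntropy (W x) (fun y => (1 - κ) * outputDist P W y + κ * W x y) ≤ mutualInfo P W := by
  classical
  let t : stdSimplex ℝ X := ⟨Pi.single x 1, single_mem_stdSimplex ℝ x⟩
  have ht : ∀ a, t a = (Pi.single x 1 : X → ℝ) a := fun _ => rfl
  obtain ⟨r, hr⟩ := exists_convexCombination P t h0.le h1.le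
  have h := sum_relEntropy_le_of_isMax hP h0 h1 hr
  have hout : outputDist r W = fun y => (1 - κ) * outputDist P W y + κ * W x y := by
    funext y
    rw [outputDist_convexCombination hr]
    simp [outputDist, ht, Pi.single_apply]
  rw [hout] at h
  simpa [ht, Pi.single_apply] using h

/-- The output distribution of a capacity-achieving input distribution charges every reachable
output letter. -/
theorem outputDist_pos_of_isMax (hP : ∀ Q, mutualInfo Q W ≤ mutualInfo P W) {x : X} {y : Y}
    (hy : 0 < W x y) : 0 < outputDist P W y := by
  classical
  by_contra hcon
  have hPy : outputDist P W y = 0 := le_antisymm (not_lt.1 hcon) (outputDist_nonneg P W y)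
  -- If PW(y) = 0, the mixture at y is κW(y|x), so y contributes W(y|x) · log(1/κ), while the other
  -- letters contribute at least R because their denominators are at most 1. With κ = 2^(-(K+1)) the
  -- total exceeds I(P, W); the exponent K + 1 keeps κ < 1 even for K = 0.
  set R := ∑ b ∈ Finset.univ.erase y, W x b * Real.logb 2 (W x b)
  obtain ⟨K, hK⟩ := exists_nat_gt ((mutualInfo P W - R) / W x y)
  have hK' : mutualInfo P W - R < W x y * (K + 1 : ℕ) := by
    rw [div_lt_iff₀ hy] at hK
    push_cast; nlinarith
  have h0 : (0 : ℝ) < (2 ^ (K + 1))⁻¹ := by positivity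
  have h1 : ((2 : ℝ) ^ (K + 1))⁻¹ < 1 := inv_lt_one_of_one_lt₀ (one_lt_pow₀ one_lt_two (by simp))
  have h := relEntropy_le_of_isMax_of_lt hP x h0 h1
  set κ : ℝ := (2 ^ (K + 1))⁻¹
  rw [relEntropy, ← Finset.add_sum_erase _ _ (Finset.mem_univ y)] at h
  have hfirst : W x y * Real.logb 2 (W x y / ((1 - κ) * outputDist P W y + κ * W x y)) =
      W x y * (K + 1 : ℕ) := by
    congr 1
    rw [hPy, mul_zero, zero_add, div_mul_cancel_right₀ (ne_of_gt hy), inv_inv, Real.logb_pow,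
      Real.logb_self_eq_one one_lt_two, mul_one]
  have hrest : R ≤ ∑ b ∈ Finset.univ.erase y,
      W x b * Real.logb 2 (W x b / ((1 - κ) * outputDist P W b + κ * W x b)) := by
    refine Finset.sum_le_sum fun b _ => ?_
    rcases ((W x).2.1 b).eq_or_lt with hb | hb
    · have : W x b = 0 := hb.symm
      simp [this]
    · have hb' : 0 < W x b := hb
      refine mul_le_mul_of_nonneg_left (Real.logb_le_logb_of_le one_lt_two hb ?_) hb.le
      have hO := outputDist_nonneg P W b
      have hO1 := outputDist_le_one P W b
      have hW1 := stdSimplex.le_one (W x) b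
      have hden : 0 < (1 - κ) * outputDist P W b + κ * W x b := by
        have := mul_pos h0 hb'
        have := mul_nonneg (sub_pos.2 h1).le hO
        linarith
      rw [le_div_iff₀ hden]
      refine mul_le_of_le_one_right hb.le ?_
      nlinarith
  linarith

/-- The Kuhn–Tucker condition, as the limit κ → 0 of the perturbation of P towards a point mass. The
limit is legitimate because PW is positive wherever W(·|x) is. -/
theorem relEntropy_le_of_isMax (hP : ∀ Q, mutualInfo Q W ≤ mutualInfo P W) (x : X) :
    relEntropy (W x) (outputDist P W) ≤ mutualInfo P W := by
  have hlim : Tendsto (fun κ : ℝ =>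
      relEntropy (W x) (fun y => (1 - κ) * outputDist P W y + κ * W x y)) (𝓝[>] 0)
      (𝓝 (relEntropy (W x) (outputDist P W))) := by
    refine Tendsto.mono_left ?_ nhdsWithin_le_nhds
    refine tendsto_finsetSum _ fun y _ => ?_
    rcases ((W x).2.1 y).eq_or_lt with hy | hy
    · have : W x y = 0 := hy.symm
      simp [this]
    have hpos := outputDist_pos_of_isMax hP hy
    have hc : ContinuousAt (fun κ : ℝ =>
        W x y * Real.logb 2 (W x y / ((1 - κ) * outputDist P W y + κ * W x y))) 0 := by
      have hne : (1 - (0 : ℝ)) * outputDist P W y + 0 * W x y ≠ 0 := by simpa using hpos.ne'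
      have hy' : W x y ≠ 0 := ne_of_gt hy
      unfold Real.logb
      refine ContinuousAt.mul continuousAt_const (ContinuousAt.div_const ?_ _)
      refine ContinuousAt.log (ContinuousAt.div continuousAt_const (by fun_prop) hne) ?_
      exact div_ne_zero hy' hne
    simpa using hc.tendsto
  refine le_of_tendsto hlim ?_
  filter_upwards [self_mem_nhdsWithin, nhdsWithin_le_nhds (gt_mem_nhds (zero_lt_one' ℝ))]
    with κ h0 h1
  exact relEntropy_le_of_isMax_of_lt hP x h0 h1

/-- The gaps in the Kuhn–Tucker inequalities are nonnegative and have P-average zero. -/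
theorem relEntropy_eq_of_isMax (hP : ∀ Q, mutualInfo Q W ≤ mutualInfo P W) {x : X}
    (hx : 0 < P x) : relEntropy (W x) (outputDist P W) = mutualInfo P W := by
  have hsum : ∑ x, P x * (mutualInfo P W - relEntropy (W x) (outputDist P W)) = 0 := by
    simp_rw [mul_sub]
    rw [Finset.sum_sub_distrib, ← Finset.sum_mul, show ∑ x, P x = 1 from P.2.2, one_mul]
    exact sub_self _
  have h := (Finset.sum_eq_zero_iff_of_nonneg fun x _ => mul_nonneg (P.2.1 x)
    (sub_nonneg.2 (relEntropy_le_of_isMax hP x))).1 hsum x (Finset.mem_univ x)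
  rcases mul_eq_zero.1 h with h | h
  · exact absurd h hx.ne'
  · linarith

end Entropy
/-! ### One-shot coding bounds -/

section OneShot

variable {X Y : Type*} [Fintype Y]

open Classical in
/-- Decoder for a family of disjoint decoding sets. -/
noncomputable def setDecoder {M : ℕ} (hM : 0 < M) (D : ℕ → Finset Y) (y : Y) : Fin M :=
  if h : ∃ j : Fin M, y ∈ D j then h.choose else ⟨0, hM⟩

theorem setDecoder_eq {Y : Type*} {M : ℕ} (hM : 0 < M) {D : ℕ → Finset Y}
    (hD : ∀ i j, i < j → j < M → Disjoint (D i) (D j)) {y : Y} {m : Fin M} (hy : y ∈ D m) :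
    setDecoder hM D y = m := by
  have h : ∃ j : Fin M, y ∈ D j := ⟨m, hy⟩
  rw [setDecoder, dif_pos h]
  have hc := h.choose_spec
  by_contra hne
  rcases lt_or_gt_of_ne hne with hlt | hlt
  · exact Finset.disjoint_left.1 (hD _ _ hlt m.2) hc hy
  · exact Finset.disjoint_left.1 (hD _ _ hlt (h.choose).2) hy hc

/-- **Feinstein's lemma**: greedy construction of decoding sets. -/
theorem exists_decodingSets [Fintype X] (V : Channel X Y) (p : stdSimplex ℝ X) {θ : ℝ}
    (hθ : 0 < θ) (M k : ℕ) (hk : k ≤ M) :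
    ∃ (f : ℕ → X) (D : ℕ → Finset Y), (∀ j < k, ∀ y ∈ D j, θ * outputDist p V y < V (f j) y) ∧
      (∀ j < k, 1 - (∑ x, p x * prob (V x) (fun y => V x y ≤ θ * outputDist p V y) + M / θ) ≤
        ∑ y ∈ D j, V (f j) y) ∧
      ∀ i j, i < j → j < k → Disjoint (D i) (D j) := by
  classical
  have hX : Nonempty X := by
    by_contra h
    rw [not_nonempty_iff] at h
    simpa using p.2.2
  set q := outputDist p V
  set e := ∑ x, p x * prob (V x) (fun y => V x y ≤ θ * q y) + M / θ
  induction k with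
  | zero => exact ⟨fun _ => hX.some, fun _ => ∅, by simp, by simp, by simp⟩
  | succ k ih =>
    obtain ⟨f, D, h1, h2, h3⟩ := ih (by omega)
    set S := (Finset.range k).biUnion D
    -- On each decoding set q is below V/θ, so the set has q-mass at most 1/θ.
    have hqS : ∑ y ∈ S, q y ≤ k / θ := by
      have hj : ∀ j ∈ Finset.range k, ∑ y ∈ D j, q y ≤ 1 / θ := by
        intro j hj
        rw [le_div_iff₀ hθ, Finset.sum_mul]
        calc ∑ y ∈ D j, q y * θ ≤ ∑ y ∈ D j, V (f j) y :=
              Finset.sum_le_sum fun y hy => by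
                rw [mul_comm]; exact (h1 j (Finset.mem_range.1 hj) y hy).le
          _ ≤ ∑ y, V (f j) y := Finset.sum_le_sum_of_subset_of_nonneg (Finset.subset_univ _)
              fun y _ _ => (V (f j)).2.1 y
          _ = 1 := (V (f j)).2.2
      calc ∑ y ∈ S, q y ≤ ∑ j ∈ Finset.range k, ∑ y ∈ D j, q y := by
            refine (Finset.sum_biUnion fun i hi j hj hij => ?_).le
            rcases lt_or_gt_of_ne hij with h | h
            · exact h3 i j h (Finset.mem_range.1 hj)
            · exact (h3 j i h (Finset.mem_range.1 hi)).symm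
        _ ≤ ∑ j ∈ Finset.range k, 1 / θ := Finset.sum_le_sum hj
        _ = k / θ := by simp [div_eq_mul_inv]
    set B : X → Finset Y := fun x => Finset.univ.filter fun y => θ * q y < V x y
    -- If no input could be added, averaging over p would force the q-mass of the used set S to be
    -- at least M/θ, although it is at most k/θ with k < M.
    obtain ⟨x, hx⟩ : ∃ x, 1 - e ≤ ∑ y ∈ B x \ S, V x y := by
      by_contra! hcon
      have hB : ∀ x, 1 - prob (V x) (fun y => V x y ≤ θ * q y) ≤
          ∑ y ∈ B x \ S, V x y + ∑ y ∈ S, V x y := by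
        intro x
        have hone : ∑ y, V x y = 1 := (V x).2.2
        rw [← hone, ← prob_add_prob_not (μ := V x) (A := fun y => V x y ≤ θ * q y),
          add_sub_cancel_left, prob_eq_sum_filter]
        simp only [not_le]
        rw [← Finset.sum_inter_add_sum_sdiff _ S, add_comm]
        refine add_le_add le_rfl ?_
        exact Finset.sum_le_sum_of_subset_of_nonneg Finset.inter_subset_right
          fun y _ _ => (V x).2.1 y
      have hsum : ∑ x, p x * (1 - prob (V x) (fun y => V x y ≤ θ * q y)) ≤
          ∑ x, p x * (1 - e + ∑ y ∈ S, V x y) :=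
        Finset.sum_le_sum fun x _ => mul_le_mul_of_nonneg_left
          ((hB x).trans (add_le_add (hcon x).le le_rfl)) (p.2.1 x)
      have hp : ∑ x, p x = 1 := p.2.2
      have hS : ∑ x, p x * ∑ y ∈ S, V x y = ∑ y ∈ S, q y := by
        simp_rw [Finset.mul_sum]
        rw [Finset.sum_comm]
        rfl
      simp_rw [mul_sub, mul_add, mul_sub, Finset.sum_add_distrib, Finset.sum_sub_distrib,
        ← Finset.sum_mul, mul_one] at hsum
      rw [hp, hS] at hsum
      have hkM : (k : ℝ) / θ < M / θ := by
        have : (k : ℝ) < M := by exact_mod_cast hk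
        gcongr
      linarith
    refine ⟨Function.update f k x, Function.update D k (B x \ S), ?_, ?_, ?_⟩
    · intro j hj y hy
      rcases Nat.lt_succ_iff_lt_or_eq.1 hj with hj | rfl
      · simp only [Function.update_of_ne hj.ne] at hy ⊢
        exact h1 j hj y hy
      · simp only [Function.update_self] at hy ⊢
        exact (Finset.mem_filter.1 (Finset.mem_sdiff.1 hy).1).2
    · intro j hj
      rcases Nat.lt_succ_iff_lt_or_eq.1 hj with hj | rfl
      · simp only [Function.update_of_ne hj.ne]
        exact h2 j hj
      · simpa only [Function.update_self] using hx
    · intro i j hij hj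
      rcases Nat.lt_succ_iff_lt_or_eq.1 hj with hj | rfl
      · rw [Function.update_of_ne hj.ne, Function.update_of_ne (hij.trans hj).ne]
        exact h3 i j hij hj
      · rw [Function.update_self, Function.update_of_ne hij.ne]
        refine (Finset.disjoint_sdiff).mono_left ?_
        exact Finset.subset_biUnion_of_mem D (Finset.mem_range.2 hij)

theorem hasAvgCode_of_sum_prob_le [Fintype X] (V : Channel X Y) (p : stdSimplex ℝ X) {θ ε : ℝ}
    (hθ : 0 < θ) {M : ℕ} (hM : 1 ≤ M)
    (h : ∑ x, p x * prob (V x) (fun y => V x y ≤ θ * outputDist p V y) + M / θ ≤ ε) :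
    HasAvgCode V M ε := by
  classical
  obtain ⟨f, D, -, h2, h3⟩ := exists_decodingSets V p hθ M M le_rfl
  refine ⟨hM, fun m => f m, setDecoder hM D, ?_⟩
  have hm : ∀ m : Fin M, ∑ y with setDecoder hM D y ≠ m, V (f m) y ≤ ε := by
    intro m
    have hsub : D m ⊆ Finset.univ.filter fun y => setDecoder hM D y = m := fun y hy =>
      Finset.mem_filter.2 ⟨Finset.mem_univ y, setDecoder_eq hM h3 hy⟩
    have hle : ∑ y ∈ D m, V (f m) y ≤ ∑ y with setDecoder hM D y = m, V (f m) y :=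
      Finset.sum_le_sum_of_subset_of_nonneg hsub fun y _ _ => (V (f m)).2.1 y
    have hone : ∑ y, V (f m) y = 1 := (V (f m)).2.2
    rw [← Finset.sum_filter_add_sum_filter_not Finset.univ
      (fun y => setDecoder hM D y = m)] at hone
    have := h2 m m.2
    linarith
  have hM0 : (0 : ℝ) < M := by exact_mod_cast hM
  rw [avgError, one_div, inv_mul_le_iff₀ hM0]
  calc _ ≤ ∑ _m : Fin M, ε := Finset.sum_le_sum fun m _ => hm m
    _ = M * ε := by simp

/-- One-shot converse for a mixture of channels, with a finite family of auxiliary output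
distributions from which each input may choose. -/
theorem sum_mul_le_avgError_add {ι τ : Type*} [Fintype ι] {V : Channel X Y} {π : ι → ℝ}
    (hπ : ∀ s, 0 ≤ π s) (hπ1 : ∑ s, π s = 1) {w : ι → X → Y → ℝ} (hw : ∀ s x y, 0 ≤ w s x y)
    (hV : ∀ x y, V x y = ∑ s, π s * w s x y) (T : Finset τ) {Q : τ → ι → Y → ℝ}
    (hQ : ∀ t s y, 0 ≤ Q t s y) (hQ1 : ∀ t s, ∑ y, Q t s y ≤ 1) {g : ι → ℝ} {θ : ℝ} (hθ : 0 ≤ θ)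
    (hg : ∀ x, ∃ t ∈ T, ∀ s, g s ≤ prob (w s x) (fun y => w s x y ≤ θ * Q t s y))
    {M : ℕ} (hM : 1 ≤ M) (f : Fin M → X) (φ : Y → Fin M) :
    ∑ s, π s * g s ≤ avgError V f φ + T.card * θ / M := by
  classical
  have hM0 : (0 : ℝ) < M := by exact_mod_cast hM
  -- Either the decoder errs, or it outputs m where w ≤ θQ, and there the measure can be changed to
  -- Q. Summing over all t in T frees the last term from the choice of t made by the codeword; since
  -- the sets φ = m partition Y, summing over m then costs at most θ · |T|.
  have key : ∀ m s, g s ≤ ∑ y with φ y ≠ m, w s (f m) y +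
      θ * ∑ t ∈ T, ∑ y with φ y = m, Q t s y := by
    intro m s
    obtain ⟨t, ht, hgt⟩ := hg (f m)
    calc g s ≤ prob (w s (f m)) (fun y => w s (f m) y ≤ θ * Q t s y) := hgt s
      _ ≤ prob (w s (f m)) (fun y => φ y ≠ m ∨ (w s (f m) y ≤ θ * Q t s y ∧ φ y = m)) :=
          prob_mono (hw s _) fun y hy => by by_cases h : φ y = m <;> simp [h, hy]
      _ ≤ prob (w s (f m)) (fun y => φ y ≠ m) +
          prob (w s (f m)) (fun y => w s (f m) y ≤ θ * Q t s y ∧ φ y = m) := prob_or_le (hw s _)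
      _ ≤ _ := by
          refine add_le_add (prob_eq_sum_filter _ _).le ?_
          calc _ ≤ θ * prob (Q t s) (fun y => w s (f m) y ≤ θ * Q t s y ∧ φ y = m) :=
                prob_le_mul_of_le fun y hy => hy.1
            _ ≤ θ * prob (Q t s) (fun y => φ y = m) :=
                mul_le_mul_of_nonneg_left (prob_mono (hQ t s) fun y hy => hy.2) hθ
            _ ≤ _ := by
                rw [prob_eq_sum_filter]
                refine mul_le_mul_of_nonneg_left ?_ hθ
                exact Finset.single_le_sum (f := fun t => ∑ y with φ y = m, Q t s y)
                  (fun t _ => Finset.sum_nonneg fun y _ => hQ t s y) ht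
  have hm : ∀ s, M * g s ≤ ∑ m, ∑ y with φ y ≠ m, w s (f m) y + θ * T.card := by
    intro s
    calc M * g s = ∑ _m : Fin M, g s := by simp
      _ ≤ ∑ m, (∑ y with φ y ≠ m, w s (f m) y + θ * ∑ t ∈ T, ∑ y with φ y = m, Q t s y) :=
          Finset.sum_le_sum fun m _ => key m s
      _ = ∑ m, ∑ y with φ y ≠ m, w s (f m) y + θ * ∑ t ∈ T, ∑ y, Q t s y := by
          rw [Finset.sum_add_distrib, ← Finset.mul_sum, Finset.sum_comm (t := T)]
          simp_rw [Finset.sum_fiberwise]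
      _ ≤ _ := by
          refine add_le_add le_rfl (mul_le_mul_of_nonneg_left ?_ hθ)
          calc _ ≤ ∑ t ∈ T, (1 : ℝ) := Finset.sum_le_sum fun t _ => hQ1 t s
            _ = T.card := by simp
  have hfin : M * ∑ s, π s * g s ≤ ∑ m, ∑ y with φ y ≠ m, V (f m) y + T.card * θ := by
    calc M * ∑ s, π s * g s = ∑ s, π s * (M * g s) := by
          rw [Finset.mul_sum]; exact Finset.sum_congr rfl fun s _ => by ring
      _ ≤ ∑ s, π s * (∑ m, ∑ y with φ y ≠ m, w s (f m) y + θ * T.card) :=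
          Finset.sum_le_sum fun s _ => mul_le_mul_of_nonneg_left (hm s) (hπ s)
      _ = _ := by
          simp_rw [mul_add, Finset.sum_add_distrib]
          rw [← Finset.sum_mul, hπ1, one_mul, mul_comm θ]
          congr 1
          simp_rw [Finset.mul_sum]
          rw [Finset.sum_comm]
          refine Finset.sum_congr rfl fun m _ => ?_
          rw [Finset.sum_comm]
          exact Finset.sum_congr rfl fun y _ => (hV _ _).symm
  rw [avgError, one_div, ← div_eq_inv_mul, ← add_div, le_div_iff₀ hM0, mul_comm]
  exact hfin

/-- Supplies the boundedness that makes the supremum in `maxCodeSize` a genuine maximum. -/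
theorem le_div_of_hasAvgCode {V : Channel X Y} {ε : ℝ} (hε : ε < 1) {M : ℕ}
    (h : HasAvgCode V M ε) : (M : ℝ) ≤ Fintype.card Y / (1 - ε) := by
  obtain ⟨hM, f, φ, hf⟩ := h
  have hM0 : (0 : ℝ) < M := by exact_mod_cast hM
  have hY : Nonempty Y := by
    by_contra h
    rw [not_nonempty_iff] at h
    simpa using (V (f ⟨0, hM⟩)).2.2
  have hc : 0 < (Fintype.card Y : ℝ) := by exact_mod_cast Fintype.card_pos
  -- With Q uniform and θ = |Y| one has θQ = 1, so the likelihood event is certain and g = 1 is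
  -- allowed.
  have := sum_mul_le_avgError_add (ι := Unit) (τ := Unit) (V := V) (π := fun _ => 1)
    (fun _ => zero_le_one) (by simp) (w := fun _ x y => V x y) (fun _ x y => (V x).2.1 y)
    (by simp) {()} (Q := fun _ _ _ => (Fintype.card Y : ℝ)⁻¹) (fun _ _ _ => (inv_pos.2 hc).le)
    (by simp [hc.ne']) (g := fun _ => 1) hc.le (fun x => ⟨(), by simp, fun _ => by
      have hone : ∑ y, V x y = 1 := (V x).2.2
      have hall : ∀ y, V x y ≤ 1 := stdSimplex.le_one (V x)
      rw [← hone, prob_eq_sum_filter, mul_inv_cancel₀ hc.ne']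
      simp [hall]⟩) hM f φ
  simp only [Finset.univ_unique, Finset.sum_const, Finset.card_singleton, one_smul, mul_one,
    Nat.cast_one, one_mul] at this
  have h2 : 1 - ε ≤ Fintype.card Y / M := by linarith
  rw [le_div_iff₀ hM0] at h2
  rw [le_div_iff₀ (sub_pos.2 hε)]
  linarith

theorem bddAbove_hasAvgCode (V : Channel X Y) {ε : ℝ} (hε : ε < 1) :
    BddAbove {M : ℕ | HasAvgCode V M ε} :=
  ⟨⌊Fintype.card Y / (1 - ε)⌋₊, fun _ hM => Nat.le_floor (le_div_of_hasAvgCode hε hM)⟩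

theorem le_maxCodeSize {V : Channel X Y} {ε : ℝ} (hε : ε < 1) {M : ℕ} (h : HasAvgCode V M ε) :
    M ≤ maxCodeSize V ε := le_csSup (bddAbove_hasAvgCode V hε) h

theorem hasAvgCode_one [Nonempty X] (V : Channel X Y) {ε : ℝ} (hε : 0 ≤ ε) :
    HasAvgCode V 1 ε := by
  classical
  refine ⟨le_rfl, fun _ => Classical.arbitrary X, fun _ => 0, ?_⟩
  simpa [avgError, Subsingleton.elim _ (0 : Fin 1)] using hε

theorem hasAvgCode_maxCodeSize [Nonempty X] (V : Channel X Y) {ε : ℝ} (hε0 : 0 ≤ ε)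
    (hε : ε < 1) : HasAvgCode V (maxCodeSize V ε) ε :=
  Nat.sSup_mem ⟨1, hasAvgCode_one V hε0⟩ (bddAbove_hasAvgCode V hε)

end OneShot
/-! ### Asymptotics of sums of information densities -/

section Asymptotics

variable {X Y : Type*} [Fintype X] [Fintype Y]

theorem tendsto_sqrt_natCast_atTop : Tendsto (fun n : ℕ => √(n : ℝ)) atTop atTop :=
  Real.tendsto_sqrt_atTop.comp tendsto_natCast_atTop_atTop

theorem eventually_mul_sqrt_lt {c : ℝ} (hc : 0 < c) (a : ℝ) :
    ∀ᶠ n : ℕ in atTop, a * √(n : ℝ) < c * n := by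
  filter_upwards [tendsto_sqrt_natCast_atTop.eventually_gt_atTop (a / c),
    tendsto_sqrt_natCast_atTop.eventually_gt_atTop 0] with n hn hn0
  rw [div_lt_iff₀ hc] at hn
  calc a * √(n : ℝ) < √(n : ℝ) * c * √(n : ℝ) := by gcongr
    _ = c * (√(n : ℝ) * √(n : ℝ)) := by ring
    _ = c * n := by rw [Real.mul_self_sqrt (Nat.cast_nonneg n)]

/-- Mean of a letter score under a channel. -/
noncomputable def letterMean (W : Channel X Y) (z : X → Y → ℝ) (a : X) : ℝ := ∑ b, W a b * z a b

theorem sum_mul_sub_letterMean {X : Type*} (W : Channel X Y) (z : X → Y → ℝ) (a : X) :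
    ∑ b, W a b * (z a b - letterMean W z a) = 0 := by
  simp_rw [mul_sub]
  rw [Finset.sum_sub_distrib, ← Finset.sum_mul, show ∑ b, W a b = 1 from (W a).2.2, one_mul]
  exact sub_self _

theorem tendsto_prob_sum_le_one (W : Channel X Y) (z : X → Y → ℝ) (t : X → ℝ) {C : ℝ}
    (h : ∑ a, t a * letterMean W z a < C) (a : ℝ) :
    Tendsto (fun p : Σ n : ℕ, Fin n → X => prob (memoryless W p.2)
      (fun y => ∑ i, z (p.2 i) (y i) ≤ p.1 * C + a * √(p.1 : ℝ))) (typeFilter t) (𝓝 1) := by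
  obtain ⟨C', hC', hC'C⟩ := exists_between h
  -- The gap between the mean and nC is at least 2nc: one nc absorbs the term a√n, the other is the
  -- threshold in Chebyshev's inequality.
  set c := (C - C') / 2 with hc
  have hc0 : 0 < c := by linarith
  set K := ∑ x, ∑ b, W x b * (z x b - letterMean W z x) ^ 2
  have hK : ∀ x, ∑ b, W x b * (z x b - letterMean W z x) ^ 2 ≤ K := fun x =>
    Finset.single_le_sum (f := fun x => ∑ b, W x b * (z x b - letterMean W z x) ^ 2)
      (fun x _ => Finset.sum_nonneg fun b _ => mul_nonneg ((W x).2.1 b) (sq_nonneg _))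
      (Finset.mem_univ x)
  have hlen := tendsto_length_typeFilter t
  have hmean : ∀ᶠ p : Σ n : ℕ, Fin n → X in typeFilter t,
      ∑ x, wordType p.2 x * letterMean W z x < C' := by
    have : Tendsto (fun p : Σ n : ℕ, Fin n → X => ∑ x, wordType p.2 x * letterMean W z x)
        (typeFilter t) (𝓝 (∑ x, t x * letterMean W z x)) :=
      tendsto_finsetSum _ fun x _ =>
        (tendsto_pi_nhds.1 (tendsto_wordType_typeFilter t) x).mul_const _
    exact this.eventually (gt_mem_nhds hC')
  have hlow : Tendsto (fun p : Σ n : ℕ, Fin n → X => 1 - (K / c ^ 2) * ((p.1 : ℝ))⁻¹)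
      (typeFilter t) (𝓝 1) := by
    have h1 : Tendsto (fun n : ℕ => 1 - (K / c ^ 2) * ((n : ℝ))⁻¹) atTop (𝓝 1) := by
      simpa using (tendsto_inv_atTop_nhds_zero_nat (𝕜 := ℝ)).const_mul (K / c ^ 2)
        |>.const_sub 1
    exact h1.comp hlen
  refine tendsto_of_tendsto_of_tendsto_of_le_of_le' hlow tendsto_const_nhds ?_
    (Eventually.of_forall fun p => ?_)
  · filter_upwards [hmean, hlen.eventually (eventually_mul_sqrt_lt hc0 (-a)),
      hlen.eventually (eventually_gt_atTop 0)] with p hp hpa hp0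
    have hn : (0 : ℝ) < p.1 := by exact_mod_cast hp0
    have hsplit := prob_add_prob_not (μ := memoryless W p.2)
      (A := fun y => ∑ i, z (p.2 i) (y i) ≤ p.1 * C + a * √(p.1 : ℝ))
    rw [sum_memoryless] at hsplit
    have hcheb := prob_memoryless_le_of_le_sum W (fun x b => z x b - letterMean W z x)
      (sum_mul_sub_letterMean W z) hK p.2 (T := p.1 * c) (by positivity)
      (A := fun y => ¬ ∑ i, z (p.2 i) (y i) ≤ p.1 * C + a * √(p.1 : ℝ)) (fun y hy => by
        refine le_trans ?_ (le_abs_self _)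
        rw [Finset.sum_sub_distrib, sum_wordType p.2 fun x => letterMean W z x]
        have h1 : (p.1 : ℝ) * ∑ x, wordType p.2 x * letterMean W z x ≤ p.1 * C' := by gcongr
        have h2 : (p.1 : ℝ) * C' + 2 * (p.1 * c) = p.1 * C := by rw [hc]; ring
        have h3 := not_le.1 hy
        linarith)
    have heq : (p.1 : ℝ) * K / (p.1 * c) ^ 2 = (K / c ^ 2) * ((p.1 : ℝ))⁻¹ := by
      field_simp
    rw [heq] at hcheb
    linarith
  · rw [← sum_memoryless W p.2]
    exact prob_le_sum (memoryless_nonneg W p.2)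

theorem tendsto_prob_sum_le_zero (W : Channel X Y) (z : X → Y → ℝ) (t : X → ℝ) {C : ℝ}
    (h : C < ∑ a, t a * letterMean W z a) (a : ℝ) :
    Tendsto (fun p : Σ n : ℕ, Fin n → X => prob (memoryless W p.2)
      (fun y => ∑ i, z (p.2 i) (y i) ≤ p.1 * C + a * √(p.1 : ℝ))) (typeFilter t) (𝓝 0) := by
  have hm : ∑ x, t x * letterMean W (fun x b => -z x b) x < -C := by
    simp only [letterMean, mul_neg, Finset.sum_neg_distrib, neg_lt_neg_iff]
    exact h
  -- Negated scores reduce to the previous limit. The complementary event is a strict inequality at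
  -- level a + 1, which contains the non-strict event at level a since √n > 0.
  have h1 := (tendsto_prob_sum_le_one W (fun x b => -z x b) t hm (-(a + 1))).const_sub 1
  rw [sub_self] at h1
  refine tendsto_of_tendsto_of_tendsto_of_le_of_le' tendsto_const_nhds h1
    (Eventually.of_forall fun p => prob_nonneg (memoryless_nonneg W p.2)) ?_
  filter_upwards [(tendsto_length_typeFilter t).eventually (eventually_gt_atTop 0)] with p hp
  have hs : 0 < √(p.1 : ℝ) := Real.sqrt_pos.2 (by exact_mod_cast hp)
  have hsplit := prob_add_prob_not (μ := memoryless W p.2)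
    (A := fun y => ∑ i, -z (p.2 i) (y i) ≤ p.1 * -C + -(a + 1) * √(p.1 : ℝ))
  rw [sum_memoryless] at hsplit
  rw [← eq_sub_iff_add_eq'.2 hsplit]
  refine prob_mono (memoryless_nonneg W p.2) fun y hy => ?_
  rw [Finset.sum_neg_distrib, not_le]
  nlinarith

/-- The information density of a letter pair. -/
noncomputable def infoDensity (W : Channel X Y) (Q : stdSimplex ℝ Y) (a : X) (b : Y) : ℝ :=
  Real.logb 2 (W a b / Q b)

theorem letterMean_infoDensity {X : Type*} (W : Channel X Y) (Q : stdSimplex ℝ Y) (a : X) :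
    letterMean W (infoDensity W Q) a = relEntropy (W a) Q := rfl

theorem memoryless_le_iff {X : Type*} {W : Channel X Y} {Q : stdSimplex ℝ Y} {n : ℕ}
    {x : Fin n → X} {y : Fin n → Y} (h : 0 < memoryless W x y) (hQ : ∀ i, 0 < Q (y i)) (r : ℝ) :
    memoryless W x y ≤ 2 ^ r * ∏ i, Q (y i) ↔ ∑ i, infoDensity W Q (x i) (y i) ≤ r := by
  have hW := pos_of_memoryless_pos h
  have hQp : 0 < ∏ i, Q (y i) := Finset.prod_pos fun i _ => hQ i
  have : ∑ i, infoDensity W Q (x i) (y i) = Real.logb 2 (memoryless W x y / ∏ i, Q (y i)) := by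
    rw [memoryless, ← Finset.prod_div_distrib, Real.logb_prod _ _ fun i _ =>
      (div_pos (hW i) (hQ i)).ne']
    rfl
  rw [this, Real.logb_le_iff_le_rpow one_lt_two (div_pos h hQp), div_le_iff₀ hQp]

/-- The limiting probability of `log-likelihood ≤ nC + a√n` in a state whose channel has capacity
`Cs` and dispersion `Vs`. -/
noncomputable def stateLimit (Cs Vs C a : ℝ) : ℝ :=
  if Cs < C then 1 else if Cs = C then gaussianCdf (a / √Vs) else 0

/-! ### Converse -/

section Converse

variable {P : stdSimplex ℝ X} {W : Channel X Y}

theorem condInfoVariance_eq (P : stdSimplex ℝ X) (W : Channel X Y) :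
    ∑ a, P a * ∑ b, W a b * (infoDensity W (outputPoint P W) a b -
      letterMean W (infoDensity W (outputPoint P W)) a) ^ 2 = condInfoVariance P W := rfl

/-- The local converse near one type t. The midpoint r keeps half of P, so its output law charges
every reachable letter and likelihood ratios stay finite even where t has no mass. -/
theorem eventually_stateLimit_sub_le (hP : ∀ Q, Q ≠ P → mutualInfo Q W < mutualInfo P W)
    (hV : 0 < condInfoVariance P W) {t r : stdSimplex ℝ X}
    (hr : ∀ x, r x = (1 - 1 / 2) * P x + 1 / 2 * t x) (C a : ℝ) {η : ℝ} (hη : 0 < η) :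
    ∀ᶠ p : Σ n : ℕ, Fin n → X in typeFilter t,
      stateLimit (mutualInfo P W) (condInfoVariance P W) C a - η ≤
        prob (memoryless W p.2) (fun y => memoryless W p.2 y ≤
          2 ^ (p.1 * C + a * √(p.1 : ℝ)) * ∏ i, outputPoint r W (y i)) := by
  have hmax : ∀ Q, mutualInfo Q W ≤ mutualInfo P W := fun Q => by
    by_cases h : Q = P
    · rw [h]
    · exact (hP Q h).le
  have hsupp : ∀ x y, 0 < W x y → 0 < outputPoint r W y := fun x y h => by
    rw [outputPoint_apply, outputDist_convexCombination hr]
    have := outputDist_pos_of_isMax hmax h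
    have := outputDist_nonneg t W y
    linarith
  suffices hs : ∀ᶠ p : Σ n : ℕ, Fin n → X in typeFilter t,
      stateLimit (mutualInfo P W) (condInfoVariance P W) C a - η ≤
        prob (memoryless W p.2) (fun y => ∑ i, infoDensity W (outputPoint r W) (p.2 i) (y i) ≤
          p.1 * C + a * √(p.1 : ℝ)) by
    filter_upwards [hs] with p hp
    refine hp.trans (prob_mono_of_pos (memoryless_nonneg W p.2) fun y hy hle => ?_)
    exact (memoryless_le_iff hy (fun i => hsupp _ _ (pos_of_memoryless_pos hy i)) _).2 hle
  have hone : ∑ x, t x * letterMean W (infoDensity W (outputPoint r W)) x < C →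
      stateLimit (mutualInfo P W) (condInfoVariance P W) C a ≤ 1 →
      ∀ᶠ p : Σ n : ℕ, Fin n → X in typeFilter t,
      stateLimit (mutualInfo P W) (condInfoVariance P W) C a - η ≤
        prob (memoryless W p.2) (fun y => ∑ i, infoDensity W (outputPoint r W) (p.2 i) (y i) ≤
          p.1 * C + a * √(p.1 : ℝ)) := fun h h1 =>
    (tendsto_prob_sum_le_one W _ t h a).eventually (le_mem_nhds (by linarith))
  have hmean : ∑ x, t x * letterMean W (infoDensity W (outputPoint r W)) x ≤ mutualInfo P W :=
    sum_relEntropy_le_of_isMax hmax one_half_pos one_half_lt_one hr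
  rcases lt_trichotomy (mutualInfo P W) C with hlt | heq | hgt
  · exact hone (hmean.trans_lt hlt) (by simp [stateLimit, hlt])
  · by_cases ht : t = P
    · subst ht
      have hrt : r = t := DFunLike.ext _ _ fun x => by rw [hr]; ring
      subst hrt
      have hlim := tendsto_prob_sum_le W (fun x b => infoDensity W (outputPoint r W) x b -
        letterMean W (infoDensity W (outputPoint r W)) x) (sum_mul_sub_letterMean W _) r
        (condInfoVariance_eq r W) hV a
      have hG : stateLimit (mutualInfo r W) (condInfoVariance r W) C a =
          gaussianCdf (a / √(condInfoVariance r W)) := by simp [stateLimit, heq]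
      rw [hG]
      filter_upwards [hlim.eventually (le_mem_nhds (sub_lt_self _ hη))] with p hp
      refine hp.trans (prob_mono (memoryless_nonneg W p.2) fun y hy => ?_)
      rw [Finset.sum_sub_distrib] at hy
      -- The type is only near P, so the mean may move on the √n scale; the Kuhn–Tucker inequality,
      -- valid for all letters, shows that it never exceeds nC, which is the direction needed.
      have : ∑ i, letterMean W (infoDensity W (outputPoint r W)) (p.2 i) ≤ p.1 * C := by
        calc _ ≤ ∑ _i : Fin p.1, C := Finset.sum_le_sum fun i _ => by
              rw [← heq]; exact relEntropy_le_of_isMax hmax (p.2 i)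
          _ = p.1 * C := by simp
      linarith
    · refine hone ?_ ?_
      · rw [← heq]
        exact sum_relEntropy_lt_of_strictMax hP ht one_half_pos one_half_lt_one hr
      · simpa [stateLimit, heq, gaussianCdf] using cdf_le_one (gaussianReal 0 1) _
  · refine Eventually.of_forall fun p => ?_
    have : stateLimit (mutualInfo P W) (condInfoVariance P W) C a = 0 := by
      simp [stateLimit, hgt.not_gt, hgt.ne']
    rw [this]
    have := prob_nonneg (memoryless_nonneg W p.2) (A := fun y =>
      ∑ i, infoDensity W (outputPoint r W) (p.2 i) (y i) ≤ p.1 * C + a * √(p.1 : ℝ))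
    linarith

end Converse

/-! ### Converse for the mixed channel, by compactness of the set of types -/

section MixedConverse

variable {P : stdSimplex ℝ X} {W : Fin 2 → Channel X Y}

theorem exists_finset_outputDist (hP : ∀ s Q, Q ≠ P → mutualInfo Q (W s) < mutualInfo P (W s))
    (hV : ∀ s, 0 < condInfoVariance P (W s)) (C a : ℝ) {η : ℝ} (hη : 0 < η) :
    ∃ (T : Finset (Fin 2 → stdSimplex ℝ Y)) (N : ℕ), ∀ n ≥ N, ∀ x : Fin n → X, ∃ Q ∈ T, ∀ s,
      stateLimit (mutualInfo P (W s)) (condInfoVariance P (W s)) C a - η ≤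
        prob (memoryless (W s) x) (fun y => memoryless (W s) x y ≤
          2 ^ (n * C + a * √(n : ℝ)) * ∏ i, Q s (y i)) := by
  classical
  suffices h : ∃ (T : Finset (Fin 2 → stdSimplex ℝ Y)) (N : ℕ), ∀ n ≥ N, ∀ x : Fin n → X,
      wordType x ∈ stdSimplex ℝ X → ∃ Q ∈ T, ∀ s,
      stateLimit (mutualInfo P (W s)) (condInfoVariance P (W s)) C a - η ≤
        prob (memoryless (W s) x) (fun y => memoryless (W s) x y ≤
          2 ^ (n * C + a * √(n : ℝ)) * ∏ i, Q s (y i)) by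
    obtain ⟨T, N, h⟩ := h
    -- The shift to N + 1 excludes the empty word, whose type is not a distribution.
    exact ⟨T, N + 1, fun n hn x => h n (by omega) x (wordType_mem_stdSimplex (by omega) x)⟩
  refine IsCompact.induction_on (isCompact_stdSimplex ℝ X)
    (p := fun S => ∃ (T : Finset (Fin 2 → stdSimplex ℝ Y)) (N : ℕ), ∀ n ≥ N, ∀ x : Fin n → X,
      wordType x ∈ S → ∃ Q ∈ T, ∀ s,
      stateLimit (mutualInfo P (W s)) (condInfoVariance P (W s)) C a - η ≤
        prob (memoryless (W s) x) (fun y => memoryless (W s) x y ≤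
          2 ^ (n * C + a * √(n : ℝ)) * ∏ i, Q s (y i))) ?_ ?_ ?_ ?_
  · exact ⟨∅, 0, fun n _ x hx => absurd hx (by simp)⟩
  · rintro S S' hSS' ⟨T, N, h⟩
    exact ⟨T, N, fun n hn x hx => h n hn x (hSS' hx)⟩
  · rintro S S' ⟨T, N, h⟩ ⟨T', N', h'⟩
    refine ⟨T ∪ T', max N N', fun n hn x hx => ?_⟩
    rcases hx with hx | hx
    · obtain ⟨Q, hQ, hQs⟩ := h n (le_trans (le_max_left _ _) hn) x hx
      exact ⟨Q, Finset.mem_union_left _ hQ, hQs⟩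
    · obtain ⟨Q, hQ, hQs⟩ := h' n (le_trans (le_max_right _ _) hn) x hx
      exact ⟨Q, Finset.mem_union_right _ hQ, hQs⟩
  · intro t ht
    obtain ⟨r, hr⟩ := exists_convexCombination P ⟨t, ht⟩ one_half_pos.le one_half_lt_one.le
    have hev := eventually_all.2 fun s =>
      eventually_stateLimit_sub_le (hP s) (hV s) hr C a hη
    -- An eventual statement along `typeFilter` unfolds into a length threshold and a neighbourhood
    -- of t, on which a single pair of output laws suffices.
    obtain ⟨A, hA, B, hB, hAB⟩ := mem_inf_iff_superset.1 hev
    obtain ⟨A', hA', hAA'⟩ := mem_comap.1 hA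
    obtain ⟨U, hU, hUB⟩ := mem_comap.1 hB
    obtain ⟨N, hN⟩ := mem_atTop_sets.1 hA'
    refine ⟨U, mem_nhdsWithin_of_mem_nhds hU, {fun s => outputPoint r (W s)}, N,
      fun n hn x hx => ⟨_, Finset.mem_singleton_self _, ?_⟩⟩
    exact hAB ⟨hAA' (show (⟨n, x⟩ : Σ n : ℕ, Fin n → X).1 ∈ A' from hN n hn),
      hUB (show wordType (⟨n, x⟩ : Σ n : ℕ, Fin n → X).2 ∈ U from hx)⟩

theorem tendsto_two_rpow_neg_mul_sqrt {δ : ℝ} (hδ : 0 < δ) :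
    Tendsto (fun n : ℕ => (2 : ℝ) ^ (-(δ * √(n : ℝ)))) atTop (𝓝 0) :=
  (tendsto_rpow_atBot_of_base_gt_one 2 one_lt_two).comp
    (tendsto_neg_atTop_atBot.comp (tendsto_sqrt_natCast_atTop.const_mul_atTop hδ))

theorem eventually_logMaxCodeSize_le (PS : stdSimplex ℝ (Fin 2))
    (hP : ∀ s Q, Q ≠ P → mutualInfo Q (W s) < mutualInfo P (W s))
    (hV : ∀ s, 0 < condInfoVariance P (W s)) {ε : ℝ} (hε0 : 0 < ε) (hε1 : ε < 1) {C a δ : ℝ}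
    (hδ : 0 < δ)
    (h : ε < ∑ s, PS s * stateLimit (mutualInfo P (W s)) (condInfoVariance P (W s)) C a) :
    ∀ᶠ n : ℕ in atTop, logMaxCodeSize W PS ε n ≤ n * C + (a + δ) * √(n : ℝ) := by
  have hX : Nonempty X := by
    by_contra h
    rw [not_nonempty_iff] at h
    simpa using P.2.2
  set G := fun s => stateLimit (mutualInfo P (W s)) (condInfoVariance P (W s)) C a with hG
  -- Half of the gap pays for the approximation of the limits, the other half for the term |T| ·
  -- θ/M.
  set η := (∑ s, PS s * G s - ε) / 2 with hη
  have hη0 : 0 < η := half_pos (sub_pos.2 h)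
  obtain ⟨T, N, hT⟩ := exists_finset_outputDist hP hV C a hη0
  have hlim : Tendsto (fun n : ℕ => T.card * (2 : ℝ) ^ (-(δ * √(n : ℝ)))) atTop (𝓝 0) := by
    simpa using (tendsto_two_rpow_neg_mul_sqrt hδ).const_mul (T.card : ℝ)
  filter_upwards [eventually_ge_atTop N, hlim.eventually (gt_mem_nhds hη0)] with n hn hnη
  by_contra! hcon
  have hcode := hasAvgCode_maxCodeSize (mixedChannel W PS n) hε0.le hε1
  rw [logMaxCodeSize] at hcon
  generalize maxCodeSize (mixedChannel W PS n) ε = M at hcode hcon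
  obtain ⟨hM, f, φ, hf⟩ := hcode
  have hM0 : (0 : ℝ) < M := by exact_mod_cast hM
  have hPS : ∑ s, PS s = 1 := PS.2.2
  have hbound := sum_mul_le_avgError_add (V := mixedChannel W PS n) (π := PS) PS.2.1 PS.2.2
    (w := fun s x y => memoryless (W s) x y) (fun s x y => memoryless_nonneg (W s) x y)
    (fun x y => rfl) T (Q := fun Q s y => ∏ i, Q s (y i))
    (fun Q s y => Finset.prod_nonneg fun i _ => (Q s).2.1 (y i))
    (fun Q s => (sum_memoryless (X := Unit) (fun _ => Q s) (n := n) fun _ => ()).le)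
    (g := fun s => G s - η) (θ := 2 ^ (n * C + a * √(n : ℝ))) (by positivity)
    (hT n hn) hM f φ
  have hMlow : (2 : ℝ) ^ (n * C + (a + δ) * √(n : ℝ)) < M :=
    (Real.lt_logb_iff_rpow_lt one_lt_two hM0).1 hcon
  have hdiv : (T.card : ℝ) * 2 ^ (n * C + a * √(n : ℝ)) / M ≤
      T.card * (2 : ℝ) ^ (-(δ * √(n : ℝ))) := by
    rw [div_le_iff₀ hM0, mul_assoc]
    refine mul_le_mul_of_nonneg_left ?_ (Nat.cast_nonneg _)
    calc (2 : ℝ) ^ (n * C + a * √(n : ℝ))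
        = 2 ^ (-(δ * √(n : ℝ))) * 2 ^ (n * C + (a + δ) * √(n : ℝ)) := by
          rw [← Real.rpow_add two_pos]; congr 1; ring
      _ ≤ _ := by gcongr
  simp_rw [mul_sub, Finset.sum_sub_distrib] at hbound
  rw [← Finset.sum_mul, hPS, one_mul] at hbound
  linarith

end MixedConverse

end Asymptotics
/-! ### Achievability -/

section Mixture

variable {X Y ι : Type*} [Fintype X] [Fintype Y] [Fintype ι]

theorem sum_mul_prob_outputDist (p : stdSimplex ℝ X) (w : Channel X Y) (A : Y → Prop) :
    ∑ x, p x * prob (w x) A = prob (outputDist p w) A := by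
  classical
  simp_rw [prob_eq_sum_filter, Finset.mul_sum]
  rw [Finset.sum_comm]
  rfl

/-- The information spectrum of a mixture is controlled by those of its components. -/
theorem sum_mul_prob_mixture_le {V : Channel X Y} {π : ι → ℝ} (hπ : ∀ s, 0 ≤ π s)
    {w : ι → Channel X Y} (hV : ∀ x y, V x y = ∑ s, π s * w s x y)
    (p : stdSimplex ℝ X) {θ K : ℝ} (hθ : 0 ≤ θ) (hK : 0 < K) :
    ∑ x, p x * prob (V x) (fun y => V x y ≤ θ * outputDist p V y) ≤
      ∑ s, π s * ∑ x, p x * prob (w s x) (fun y => w s x y ≤ θ * K * outputDist p (w s) y) +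
        Fintype.card ι / K := by
  classical
  have hmix : ∀ x (A : Y → Prop), prob (V x) A = ∑ s, π s * prob (w s x) A := by
    intro x A
    simp_rw [prob_eq_sum_filter, hV, Finset.mul_sum]
    rw [Finset.sum_comm]
  have hq : ∑ y, outputDist p V y = 1 := sum_outputDist p V
  have hs : ∀ s, π s * ∑ x, p x * prob (w s x) (fun y => V x y ≤ θ * outputDist p V y) ≤
      π s * ∑ x, p x * prob (w s x) (fun y => w s x y ≤ θ * K * outputDist p (w s) y) + 1 / K := by
    intro s
    rcases (hπ s).eq_or_lt with h0 | h0
    · rw [← h0, zero_mul, zero_mul, zero_add]; positivity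
    -- As π_s w_s ≤ V, smallness of V relative to its output law forces smallness of w_s relative to
    -- its own, up to the factor K, unless the output law of V is at least π_s K times that of w_s.
    have hx : ∀ x, prob (w s x) (fun y => V x y ≤ θ * outputDist p V y) ≤
        prob (w s x) (fun y => w s x y ≤ θ * K * outputDist p (w s) y) +
        prob (w s x) (fun y => π s * K * outputDist p (w s) y ≤ outputDist p V y) := by
      intro x
      refine (prob_mono (w s x).2.1 fun y hy => ?_).trans (prob_or_le (w s x).2.1)
      by_contra! hcon
      have h1 : π s * w s x y ≤ V x y := by
        rw [hV]
        exact Finset.single_le_sum (f := fun s => π s * w s x y)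
          (fun s _ => mul_nonneg (hπ s) ((w s x).2.1 y)) (Finset.mem_univ s)
      have h2 := mul_lt_mul_of_pos_left hcon.1 h0
      have h3 := mul_le_mul_of_nonneg_left hcon.2.le hθ
      linarith
    -- A change of measure to the output law of V. The factor 1/π_s is cancelled by the weight of
    -- the state, so no lower bound on positive weights is needed.
    have hq2 : prob (outputDist p (w s))
        (fun y => π s * K * outputDist p (w s) y ≤ outputDist p V y) ≤ 1 / (π s * K) := by
      have hp : 0 < π s * K := mul_pos h0 hK
      refine (prob_le_mul_of_le (ν := outputDist p V) (c := 1 / (π s * K)) fun y hy => ?_).trans ?_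
      · rw [div_mul_eq_mul_div, one_mul, le_div_iff₀ hp, mul_comm]; exact hy
      · refine mul_le_of_le_one_right (by positivity) ?_
        rw [← hq]
        exact prob_le_sum (outputDist_nonneg p V)
    calc _ ≤ π s * ∑ x, p x * (prob (w s x) (fun y => w s x y ≤ θ * K * outputDist p (w s) y) +
          prob (w s x) (fun y => π s * K * outputDist p (w s) y ≤ outputDist p V y)) :=
          mul_le_mul_of_nonneg_left (Finset.sum_le_sum fun x _ =>
            mul_le_mul_of_nonneg_left (hx x) (p.2.1 x)) h0.le
      _ ≤ π s * (∑ x, p x * prob (w s x) (fun y => w s x y ≤ θ * K * outputDist p (w s) y) +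
          1 / (π s * K)) := by
          simp_rw [mul_add, Finset.sum_add_distrib]
          rw [sum_mul_prob_outputDist p (w s)
            (fun y => π s * K * outputDist p (w s) y ≤ outputDist p V y)]
          exact (mul_le_mul_of_nonneg_left (add_le_add le_rfl hq2) h0.le).trans_eq (mul_add _ _ _)
      _ = _ := by field_simp
  calc _ = ∑ s, π s * ∑ x, p x * prob (w s x) (fun y => V x y ≤ θ * outputDist p V y) := by
        simp_rw [hmix, Finset.mul_sum]
        rw [Finset.sum_comm]
        exact Finset.sum_congr rfl fun s _ => Finset.sum_congr rfl fun x _ => by ring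
    _ ≤ ∑ s, (π s * ∑ x, p x * prob (w s x) (fun y => w s x y ≤ θ * K * outputDist p (w s) y) +
        1 / K) := Finset.sum_le_sum fun s _ => hs s
    _ = _ := by
        rw [Finset.sum_add_distrib]
        simp [div_eq_mul_inv]

end Mixture

/-! ### The information spectrum under i.i.d. inputs -/

section Achievability

variable {X Y : Type*} [Fintype X] [Fintype Y]

/-- The product distribution `P^n`. -/
noncomputable def iidDist (P : stdSimplex ℝ X) (n : ℕ) : stdSimplex ℝ (Fin n → X) :=
  ⟨fun x => ∏ i, P (x i), fun x => Finset.prod_nonneg fun i _ => P.2.1 (x i),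
    sum_memoryless (X := Unit) (fun _ => P) fun _ => ()⟩

/-- The memoryless extension, as a channel between words. -/
noncomputable def memorylessChannel {X : Type*} (W : Channel X Y) (n : ℕ) :
    Channel (Fin n → X) (Fin n → Y) := fun x =>
  ⟨memoryless W x, memoryless_nonneg W x, sum_memoryless W x⟩

theorem iidDist_mul_memorylessChannel (P : stdSimplex ℝ X) (W : Channel X Y) {n : ℕ}
    (x : Fin n → X) (y : Fin n → Y) :
    iidDist P n x * memorylessChannel W n x y = ∏ i, P (x i) * W (x i) (y i) := by
  rw [Finset.prod_mul_distrib]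
  rfl

theorem outputDist_iidDist (P : stdSimplex ℝ X) (W : Channel X Y) (n : ℕ) (y : Fin n → Y) :
    outputDist (iidDist P n) (memorylessChannel W n) y = ∏ i, outputPoint P W (y i) := by
  classical
  simp only [outputPoint_apply]
  unfold outputDist
  rw [Fintype.prod_sum (fun i x => P x * W x (y i))]
  exact Finset.sum_congr rfl fun x _ => iidDist_mul_memorylessChannel P W x y

/-- The joint distribution of input and output, as a channel with trivial input. -/
noncomputable def jointChannel (P : stdSimplex ℝ X) (W : Channel X Y) : Channel Unit (X × Y) :=
  fun _ => ⟨fun w => P w.1 * W w.1 w.2, fun w => mul_nonneg (P.2.1 w.1) ((W w.1).2.1 w.2), by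
    rw [Fintype.sum_prod_type]
    simp_rw [← Finset.mul_sum]
    calc ∑ x, P x * ∑ y, W x y = ∑ x, P x := Finset.sum_congr rfl fun x _ => by
          rw [show ∑ y, W x y = 1 from (W x).2.2, mul_one]
      _ = 1 := P.2.2⟩

theorem jointChannel_apply (P : stdSimplex ℝ X) (W : Channel X Y) (u : Unit) (w : X × Y) :
    jointChannel P W u w = P w.1 * W w.1 w.2 := rfl

/-- Under P^n the input-output pairs are i.i.d.; viewed as outputs of a channel with one input
letter, they come under the limit theorems already available for words. -/
theorem sum_iidDist_mul_prob (P : stdSimplex ℝ X) (W : Channel X Y) {n : ℕ}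
    (A : (Fin n → X) → (Fin n → Y) → Prop) :
    ∑ x, iidDist P n x * prob (memorylessChannel W n x) (A x) =
      prob (memoryless (jointChannel P W) fun _ : Fin n => ())
        (fun w => A (fun i => (w i).1) (fun i => (w i).2)) := by
  classical
  simp_rw [prob_eq_sum_ite, Finset.mul_sum]
  rw [← Fintype.sum_prod_type' (f := fun (x : Fin n → X) (y : Fin n → Y) =>
    iidDist P n x * if A x y then memorylessChannel W n x y else 0)]
  refine (Fintype.sum_equiv (Equiv.arrowProdEquivProdArrow (Fin n) (fun _ => X) (fun _ => Y)) _ _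
    fun w => ?_).symm
  by_cases h : A (fun i => (w i).1) (fun i => (w i).2)
  · exact (if_pos h).trans ((iidDist_mul_memorylessChannel P W (fun i => (w i).1)
      (fun i => (w i).2)).symm.trans (congrArg (iidDist P n (fun i => (w i).1) * ·)
        (if_pos h).symm))
  · exact (if_neg h).trans ((mul_zero (iidDist P n (fun i => (w i).1))).symm.trans
      (congrArg (iidDist P n (fun i => (w i).1) * ·) (if_neg h).symm))

/-- Over a one-letter alphabet every nonempty word has type 1, so limits along types become ordinary
limits in n. -/
theorem tendsto_typeFilter_unit :
    Tendsto (fun n : ℕ => (⟨n, fun _ => ()⟩ : Σ n : ℕ, Fin n → Unit)) atTop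
      (typeFilter fun _ => 1) := by
  refine tendsto_inf.2 ⟨tendsto_comap_iff.2 tendsto_id, tendsto_comap_iff.2 ?_⟩
  refine tendsto_const_nhds.congr' ?_
  filter_upwards [eventually_gt_atTop 0] with n hn
  funext u
  have : (n : ℝ) ≠ 0 := by positivity
  simp [wordType, this]

variable {P : stdSimplex ℝ X} {W : Channel X Y}

theorem eventually_sum_prob_le_stateLimit (hP : ∀ Q, mutualInfo Q W ≤ mutualInfo P W)
    (hV : 0 < condInfoVariance P W) (C a : ℝ) {η : ℝ} (hη : 0 < η) :
    ∀ᶠ n : ℕ in atTop, ∑ x, iidDist P n x * prob (memorylessChannel W n x)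
        (fun y => memorylessChannel W n x y ≤ 2 ^ (n * C + a * √(n : ℝ)) *
          outputDist (iidDist P n) (memorylessChannel W n) y) ≤
      stateLimit (mutualInfo P W) (condInfoVariance P W) C a + η := by
  set z : Unit → X × Y → ℝ := fun _ w => infoDensity W (outputPoint P W) w.1 w.2 with hz
  have hmean : letterMean (jointChannel P W) z () = mutualInfo P W := by
    simp only [letterMean, jointChannel_apply]
    rw [Fintype.sum_prod_type, mutualInfo]
    refine Finset.sum_congr rfl fun x _ => ?_
    rw [relEntropy, Finset.mul_sum]
    exact Finset.sum_congr rfl fun y _ => by rw [mul_assoc]; rfl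
  have hvar : ∑ u : Unit, 1 * ∑ w, jointChannel P W u w *
      (z u w - letterMean (jointChannel P W) z u) ^ 2 = condInfoVariance P W := by
    simp only [Finset.univ_unique, Finset.sum_singleton, one_mul]
    rw [show (default : Unit) = () from rfl, hmean, Fintype.sum_prod_type, ← condInfoVariance_eq]
    refine Finset.sum_congr rfl fun x _ => ?_
    rw [Finset.mul_sum]
    refine Finset.sum_congr rfl fun y _ => ?_
    rw [jointChannel_apply, mul_assoc]
    rcases (P.2.1 x).eq_or_lt with hx | hx
    · have : P x = 0 := hx.symm
      simp [this]
    · rw [letterMean_infoDensity]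
      -- The joint law centres the information density at I(P, W), the conditional variance at the
      -- divergence of the letter; on the support of a CAID the two centres agree.
      have : relEntropy (W x) (outputPoint P W) = mutualInfo P W := relEntropy_eq_of_isMax hP hx
      rw [this]
  suffices hs : ∀ᶠ n : ℕ in atTop, prob (memoryless (jointChannel P W) fun _ : Fin n => ())
      (fun w => ∑ i, z () (w i) ≤ n * C + a * √(n : ℝ)) ≤
      stateLimit (mutualInfo P W) (condInfoVariance P W) C a + η by
    filter_upwards [hs] with n hn
    refine le_trans ?_ hn
    rw [sum_iidDist_mul_prob P W (fun x y => memorylessChannel W n x y ≤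
      2 ^ (n * C + a * √(n : ℝ)) * outputDist (iidDist P n) (memorylessChannel W n) y)]
    refine prob_mono_of_pos (memoryless_nonneg _ _) fun w hw hle => ?_
    have hpos : ∀ i, 0 < P (w i).1 * W (w i).1 (w i).2 := pos_of_memoryless_pos hw
    have hWpos : ∀ i, 0 < W (w i).1 (w i).2 := fun i =>
      pos_of_mul_pos_right (hpos i) (P.2.1 _)
    have hPpos : ∀ i, 0 < P (w i).1 := fun i => pos_of_mul_pos_left (hpos i) (hWpos i).le
    rw [outputDist_iidDist] at hle
    exact (memoryless_le_iff (Q := outputPoint P W) (Finset.prod_pos fun i _ => hWpos i)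
      (fun i => outputDist_pos (hPpos i) (hWpos i)) _).1 hle
  rcases lt_trichotomy (mutualInfo P W) C with hlt | heq | hgt
  · refine Eventually.of_forall fun n => ?_
    have h1 : stateLimit (mutualInfo P W) (condInfoVariance P W) C a = 1 := by
      simp [stateLimit, hlt]
    rw [h1]
    refine (prob_le_sum (memoryless_nonneg _ _)).trans ?_
    rw [sum_memoryless]
    linarith
  · have h1 : stateLimit (mutualInfo P W) (condInfoVariance P W) C a =
        gaussianCdf (a / √(condInfoVariance P W)) := by simp [stateLimit, heq]
    rw [h1]
    have hlim := (tendsto_prob_sum_le (jointChannel P W) (fun u w => z u w -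
      letterMean (jointChannel P W) z u) (sum_mul_sub_letterMean _ z) (fun _ => 1) hvar hV a).comp
      tendsto_typeFilter_unit
    filter_upwards [hlim.eventually (ge_mem_nhds (lt_add_of_pos_right _ hη))] with n hn
    refine le_trans (prob_mono (memoryless_nonneg _ _) fun w hw => ?_) hn
    simp only [hmean, Finset.sum_sub_distrib, Finset.sum_const, Finset.card_univ,
      Fintype.card_fin, nsmul_eq_mul, heq]
    linarith
  · have h1 : stateLimit (mutualInfo P W) (condInfoVariance P W) C a = 0 := by
      simp [stateLimit, hgt.not_gt, hgt.ne']
    rw [h1]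
    have hm : C < ∑ u : Unit, (fun _ => (1 : ℝ)) u * letterMean (jointChannel P W) z u := by
      simp only [Finset.univ_unique, Finset.sum_singleton, one_mul]
      exact hgt.trans_eq hmean.symm
    have hlim := (tendsto_prob_sum_le_zero (jointChannel P W) z _ hm a).comp
      tendsto_typeFilter_unit
    exact hlim.eventually (ge_mem_nhds (by linarith))

end Achievability

/-! ### Achievability for the mixed channel -/

section MixedAchievability

variable {X Y : Type*} [Fintype X] [Fintype Y] {P : stdSimplex ℝ X} {W : Fin 2 → Channel X Y}

theorem eventually_le_logMaxCodeSize (PS : stdSimplex ℝ (Fin 2))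
    (hP : ∀ s Q, mutualInfo Q (W s) ≤ mutualInfo P (W s))
    (hV : ∀ s, 0 < condInfoVariance P (W s)) {ε : ℝ} (hε1 : ε < 1) {C a δ : ℝ} (hδ : 0 < δ)
    (h : ∑ s, PS s * stateLimit (mutualInfo P (W s)) (condInfoVariance P (W s)) C a < ε) :
    ∀ᶠ n : ℕ in atTop, n * C + (a - δ) * √(n : ℝ) ≤ logMaxCodeSize W PS ε n := by
  set G := fun s => stateLimit (mutualInfo P (W s)) (condInfoVariance P (W s)) C a with hG
  set η := (ε - ∑ s, PS s * G s) / 2 with hη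
  have hη0 : 0 < η := half_pos (sub_pos.2 h)
  have hPS : ∑ s, PS s = 1 := PS.2.2
  -- The constant 4 collects two errors of 2 · 2^(-δ√n/2): one from M/θ, one from 2/K.
  have hlim : Tendsto (fun n : ℕ => 4 * (2 : ℝ) ^ (-(δ / 2 * √(n : ℝ)))) atTop (𝓝 0) := by
    simpa using (tendsto_two_rpow_neg_mul_sqrt (half_pos hδ)).const_mul 4
  filter_upwards [hlim.eventually (ge_mem_nhds hη0), eventually_all.2 fun s =>
    eventually_sum_prob_le_stateLimit (hP s) (hV s) C a hη0] with n hn hsn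
  set r := n * C + (a - δ) * √(n : ℝ) with hr
  -- For r ≤ 0 there is nothing to build; otherwise 2^r ≥ 1, and rounding up at most doubles it.
  rcases le_or_gt r 0 with hr0 | hr0
  · refine hr0.trans ?_
    rw [logMaxCodeSize, Real.logb]
    exact div_nonneg (Real.log_natCast_nonneg _) (Real.log_nonneg one_le_two)
  have hr1 : (1 : ℝ) ≤ 2 ^ r := Real.one_le_rpow one_le_two hr0.le
  set θ : ℝ := 2 ^ (n * C + (a - δ / 2) * √(n : ℝ)) with hθ
  set K : ℝ := 2 ^ (δ / 2 * √(n : ℝ)) with hK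
  have hθ0 : 0 < θ := by positivity
  have hK0 : 0 < K := by positivity
  have hθK : θ * K = 2 ^ (n * C + a * √(n : ℝ)) := by
    rw [hθ, hK, ← Real.rpow_add two_pos]; congr 1; ring
  have hrθ : (2 : ℝ) ^ r = θ * 2 ^ (-(δ / 2 * √(n : ℝ))) := by
    rw [hθ, hr, ← Real.rpow_add two_pos]; congr 1; ring
  have hM1 : 1 ≤ ⌈(2 : ℝ) ^ r⌉₊ := Nat.one_le_ceil_iff.2 (by positivity)
  have hM2 : (⌈(2 : ℝ) ^ r⌉₊ : ℝ) / θ ≤ 2 * 2 ^ (-(δ / 2 * √(n : ℝ))) := by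
    rw [div_le_iff₀ hθ0]
    have := (Nat.ceil_lt_add_one (zero_le_one.trans hr1)).le
    linarith
  have hmix := sum_mul_prob_mixture_le (V := mixedChannel W PS n) (π := PS) PS.2.1
    (w := fun s => memorylessChannel (W s) n) (fun x y => rfl) (iidDist P n) hθ0.le hK0
  rw [hθK] at hmix
  have hcard : (Fintype.card (Fin 2) : ℝ) / K = 2 * 2 ^ (-(δ / 2 * √(n : ℝ))) := by
    rw [Real.rpow_neg two_pos.le, Fintype.card_fin, hK]; rfl
  rw [hcard] at hmix
  have hsum : ∑ s, PS s * ∑ x, iidDist P n x * prob (memorylessChannel (W s) n x)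
      (fun y => memorylessChannel (W s) n x y ≤ 2 ^ (n * C + a * √(n : ℝ)) *
        outputDist (iidDist P n) (memorylessChannel (W s) n) y) ≤ ∑ s, PS s * (G s + η) :=
    Finset.sum_le_sum fun s _ => mul_le_mul_of_nonneg_left (hsn s) (PS.2.1 s)
  simp_rw [mul_add, Finset.sum_add_distrib] at hsum
  rw [← Finset.sum_mul, hPS, one_mul] at hsum
  have hcode := hasAvgCode_of_sum_prob_le (mixedChannel W PS n) (iidDist P n) (ε := ε) hθ0 hM1
    (by linarith)
  have hle := le_maxCodeSize hε1 hcode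
  rw [logMaxCodeSize, Real.le_logb_iff_rpow_le one_lt_two
    (by exact_mod_cast hM1.trans hle)]
  exact (Nat.le_ceil _).trans (by exact_mod_cast hle)

end MixedAchievability
/-! ### The Gaussian distribution function and its inverse -/

section Gaussian

open MeasureTheory

/-- A distribution function can jump only at atoms, and the Gaussian law has none. -/
theorem continuous_gaussianCdf : Continuous gaussianCdf := by
  refine continuous_iff_continuousAt.2 fun a => ?_
  have h0 : (cdf (gaussianReal 0 1)).measure {a} = 0 := by
    have : NullSingletonClass (gaussianReal 0 1) := nullSingletonClass_gaussianReal one_ne_zero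
    rw [measure_cdf]
    exact measure_singleton a
  rw [StieltjesFunction.measure_singleton, ENNReal.ofReal_eq_zero] at h0
  have hle := (monotone_cdf (gaussianReal 0 1)).leftLim_le (le_refl a)
  exact (monotone_cdf (gaussianReal 0 1)).continuousAt_iff_leftLim_eq_rightLim.2 (by
    rw [StieltjesFunction.rightLim_eq]; linarith)

/-- Equal values at a < b would make (a, b] Gaussian-null, hence Lebesgue-null. -/
theorem strictMono_gaussianCdf : StrictMono gaussianCdf := by
  intro a b hab
  refine lt_of_le_of_ne (monotone_cdf _ hab.le) fun heq => ?_
  have h0 : (cdf (gaussianReal 0 1)).measure (Set.Ioc a b) = 0 := by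
    rw [StieltjesFunction.measure_Ioc, ENNReal.ofReal_eq_zero]
    exact (sub_eq_zero.2 heq.symm).le
  rw [measure_cdf] at h0
  have h1 := gaussianReal_absolutelyContinuous' 0 one_ne_zero h0
  rw [Real.volume_Ioc, ENNReal.ofReal_eq_zero] at h1
  linarith

theorem gaussianCdf_pos (y : ℝ) : 0 < gaussianCdf y :=
  (cdf_nonneg (gaussianReal 0 1) (y - 1)).trans_lt (strictMono_gaussianCdf (sub_one_lt y))

theorem exists_gaussianCdf_comb_eq {p q σ τ c : ℝ} (hpq : p + q = 1)
    (hc0 : 0 < c) (hc1 : c < 1) (hσ : 0 < σ) (hτ : 0 < τ) :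
    ∃ y, p * gaussianCdf (y / σ) + q * gaussianCdf (y / τ) = c := by
  have hcont : Continuous fun y => p * gaussianCdf (y / σ) + q * gaussianCdf (y / τ) :=
    ((continuous_gaussianCdf.comp (continuous_id.div_const σ)).const_mul p).add
      ((continuous_gaussianCdf.comp (continuous_id.div_const τ)).const_mul q)
  have hbot : Tendsto (fun y => p * gaussianCdf (y / σ) + q * gaussianCdf (y / τ)) atBot
      (𝓝 0) := by
    have h1 := ((tendsto_cdf_atBot (gaussianReal 0 1)).comp
      (tendsto_id.atBot_div_const hσ)).const_mul p
    have h2 := ((tendsto_cdf_atBot (gaussianReal 0 1)).comp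
      (tendsto_id.atBot_div_const hτ)).const_mul q
    have h3 := h1.add h2
    rw [mul_zero, mul_zero, add_zero] at h3
    exact h3
  have htop : Tendsto (fun y => p * gaussianCdf (y / σ) + q * gaussianCdf (y / τ)) atTop
      (𝓝 1) := by
    have h1 := ((tendsto_cdf_atTop (gaussianReal 0 1)).comp
      (tendsto_id.atTop_div_const hσ)).const_mul p
    have h2 := ((tendsto_cdf_atTop (gaussianReal 0 1)).comp
      (tendsto_id.atTop_div_const hτ)).const_mul q
    have h3 := h1.add h2
    rw [mul_one, mul_one, hpq] at h3
    exact h3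
  exact mem_range_of_exists_le_of_exists_ge hcont
    ((hbot.eventually (ge_mem_nhds hc0)).exists) ((htop.eventually (le_mem_nhds hc1)).exists)

theorem strictMono_gaussianCdf_comb {p q σ τ : ℝ} (hp : 0 ≤ p) (hq : 0 ≤ q) (hpq : p + q = 1)
    (hσ : 0 < σ) (hτ : 0 < τ) :
    StrictMono fun y => p * gaussianCdf (y / σ) + q * gaussianCdf (y / τ) := by
  intro a b hab
  have h1 := strictMono_gaussianCdf (div_lt_div_of_pos_right hab hσ)
  have h2 := strictMono_gaussianCdf (div_lt_div_of_pos_right hab hτ)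
  rcases hp.eq_or_lt with hp | hp
  · have hq1 : q = 1 := by linarith
    simpa [← hp, hq1] using h2
  · exact add_lt_add_of_lt_of_le (mul_lt_mul_of_pos_left h1 hp)
      (mul_le_mul_of_nonneg_left h2.le hq)

theorem gaussianCdfInv_gaussianCdf (y : ℝ) : gaussianCdfInv (gaussianCdf y) = (y : EReal) := by
  have : {x : ℝ | gaussianCdf x ≤ gaussianCdf y} = Set.Iic y := by
    ext x; exact strictMono_gaussianCdf.le_iff_le
  rw [gaussianCdfInv, this]
  refine IsGreatest.csSup_eq ⟨⟨y, Set.self_mem_Iic, rfl⟩, ?_⟩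
  rintro _ ⟨x, hx, rfl⟩
  exact EReal.coe_le_coe_iff.2 hx

theorem gaussianCdfInv_zero : gaussianCdfInv 0 = ⊥ := by
  have : {x : ℝ | gaussianCdf x ≤ 0} = ∅ := by
    ext x; simpa using gaussianCdf_pos x
  rw [gaussianCdfInv, this]
  simp

theorem exists_gaussianCdf_eq {c : ℝ} (hc0 : 0 < c) (hc1 : c < 1) : ∃ y, gaussianCdf y = c := by
  simpa using exists_gaussianCdf_comb_eq (p := 1) (q := 0) (σ := 1) (τ := 1) (c := c)
    (by norm_num) hc0 hc1 one_pos one_pos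

end Gaussian

/-! ### Second-order coding rates -/

section Rates

variable {X Y : Type*} [Fintype X] [Fintype Y] {P : stdSimplex ℝ X} {W : Fin 2 → Channel X Y}

/-- Stated through inequalities on either side of L, so that L = -∞ needs no separate treatment. -/
theorem hasSecondOrderRate_of_forall_lt (PS : stdSimplex ℝ (Fin 2))
    (hP : ∀ s Q, Q ≠ P → mutualInfo Q (W s) < mutualInfo P (W s))
    (hV : ∀ s, 0 < condInfoVariance P (W s)) {ε : ℝ} (hε0 : 0 < ε) (hε1 : ε < 1) {C : ℝ}
    {L : EReal}
    (hlow : ∀ a : ℝ, (a : EReal) < L →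
      ∑ s, PS s * stateLimit (mutualInfo P (W s)) (condInfoVariance P (W s)) C a < ε)
    (hup : ∀ a : ℝ, L < (a : EReal) →
      ε < ∑ s, PS s * stateLimit (mutualInfo P (W s)) (condInfoVariance P (W s)) C a) :
    HasSecondOrderRate W PS ε C L := by
  have hmax : ∀ s Q, mutualInfo Q (W s) ≤ mutualInfo P (W s) := fun s Q => by
    by_cases h : Q = P
    · rw [h]
    · exact (hP s Q h).le
  refine tendsto_order.2 ⟨fun b hb => ?_, fun b hb => ?_⟩
  · obtain ⟨a', hba, haL⟩ := EReal.lt_iff_exists_real_btwn.1 hb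
    -- A second intermediate point is taken so that the difference a - a' can serve as the slack δ.
    obtain ⟨a, haa, haL⟩ := EReal.lt_iff_exists_real_btwn.1 haL
    have haa' : 0 < a - a' := sub_pos.2 (EReal.coe_lt_coe_iff.1 haa)
    filter_upwards [eventually_le_logMaxCodeSize PS hmax hV hε1 haa' (hlow a haL),
      eventually_gt_atTop 0] with n hn hn0
    refine hba.trans_le (EReal.coe_le_coe_iff.2 ?_)
    have hs : 0 < √(n : ℝ) := Real.sqrt_pos.2 (by exact_mod_cast hn0)
    rw [le_div_iff₀ hs]
    rw [sub_sub_cancel] at hn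
    linarith
  · obtain ⟨a', hLa, hab⟩ := EReal.lt_iff_exists_real_btwn.1 hb
    obtain ⟨a, hLa, haa⟩ := EReal.lt_iff_exists_real_btwn.1 hLa
    have haa' : 0 < a' - a := sub_pos.2 (EReal.coe_lt_coe_iff.1 haa)
    filter_upwards [eventually_logMaxCodeSize_le PS hP hV hε0 hε1 haa' (hup a hLa),
      eventually_gt_atTop 0] with n hn hn0
    refine lt_of_le_of_lt (EReal.coe_le_coe_iff.2 ?_) hab
    have hs : 0 < √(n : ℝ) := Real.sqrt_pos.2 (by exact_mod_cast hn0)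
    rw [div_le_iff₀ hs]
    rw [add_sub_cancel] at hn
    linarith

theorem epsCapacity_eq_of_hasSecondOrderRate {X Y : Type*} [Fintype Y] {W : Fin 2 → Channel X Y}
    {PS : stdSimplex ℝ (Fin 2)} {ε C l : ℝ} (h : HasSecondOrderRate W PS ε C (l : EReal)) :
    epsCapacity W PS ε = C := by
  have h1 : Tendsto (fun n : ℕ => (logMaxCodeSize W PS ε n - n * C) / √(n : ℝ)) atTop (𝓝 l) :=
    EReal.tendsto_coe.1 h
  have h2 := (h1.mul (tendsto_inv_atTop_zero.comp tendsto_sqrt_natCast_atTop)).add_const C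
  rw [mul_zero, zero_add] at h2
  refine (h2.congr' ?_).liminf_eq
  filter_upwards [eventually_gt_atTop 0] with n hn
  have hn0 : (n : ℝ) ≠ 0 := by positivity
  have hs : √(n : ℝ) ≠ 0 := by positivity
  simp only [Function.comp]
  have hsq : √(n : ℝ) * √(n : ℝ) = n := Real.mul_self_sqrt (Nat.cast_nonneg n)
  rw [← div_eq_mul_inv, div_div, hsq]
  field_simp
  ring

end Rates

end MixedChannel

/-! ### Evaluation of the averaged limit in the three cases -/

theorem mainTheorem9 {X Y : Type*} [Fintype X] [Fintype Y]
    (W : Fin 2 → MixedChannel.Channel X Y) (PS : stdSimplex ℝ (Fin 2))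
    (P : stdSimplex ℝ X) (hP : ∀ s, MixedChannel.caids (W s) = {P})
    (ε : ℝ) (hε0 : 0 < ε) (hε1 : ε < 1)
    (hV : ∀ s, 0 < MixedChannel.dispersion (W s) ε) :
    -- Case (i)
    (MixedChannel.capacity (W 0) = MixedChannel.capacity (W 1) →
      MixedChannel.epsCapacity W PS ε = MixedChannel.capacity (W 0) ∧
      ∃ l : ℝ,
        (∀ l' : ℝ,
          PS 0 * MixedChannel.gaussianCdf (l' / √(MixedChannel.dispersion (W 0) ε)) +
            PS 1 * MixedChannel.gaussianCdf (l' / √(MixedChannel.dispersion (W 1) ε)) = ε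
          ↔ l' = l) ∧
        MixedChannel.HasSecondOrderRate W PS ε (MixedChannel.capacity (W 0)) (l : EReal)) ∧
    -- Case (ii)
    (MixedChannel.capacity (W 0) < MixedChannel.capacity (W 1) → ε < PS 0 →
      MixedChannel.epsCapacity W PS ε = MixedChannel.capacity (W 0) ∧
      MixedChannel.HasSecondOrderRate W PS ε (MixedChannel.capacity (W 0))
        ((√(MixedChannel.dispersion (W 0) ε) : ℝ) * MixedChannel.gaussianCdfInv (ε / PS 0))) ∧
    -- Case (iii)
    (MixedChannel.capacity (W 0) < MixedChannel.capacity (W 1) → PS 0 ≤ ε →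
      (PS 0 < ε → MixedChannel.epsCapacity W PS ε = MixedChannel.capacity (W 1)) ∧
      MixedChannel.HasSecondOrderRate W PS ε (MixedChannel.capacity (W 1))
        ((√(MixedChannel.dispersion (W 1) ε) : ℝ) *
          MixedChannel.gaussianCdfInv ((ε - PS 0) / PS 1)) ∧
      (PS 0 = ε →
        MixedChannel.HasSecondOrderRate W PS ε (MixedChannel.capacity (W 1)) ⊥)) := by
  open MixedChannel in
  have hI : ∀ s, mutualInfo P (W s) = capacity (W s) := fun s => by
    have : P ∈ caids (W s) := by rw [hP]; rfl
    exact this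
  have hstrict : ∀ s Q, Q ≠ P → mutualInfo Q (W s) < mutualInfo P (W s) := fun s Q hQ => by
    refine lt_of_le_of_ne ((mutualInfo_le_capacity Q (W s)).trans_eq (hI s).symm) fun h => hQ ?_
    have : Q ∈ caids (W s) := h.trans (hI s)
    rw [hP] at this
    exact this
  have hdisp : ∀ s, dispersion (W s) ε = condInfoVariance P (W s) := fun s =>
    dispersion_eq_of_unique (hP s) ε
  have hV' : ∀ s, 0 < condInfoVariance P (W s) := fun s => hdisp s ▸ hV s
  have hsq : ∀ s, 0 < √(condInfoVariance P (W s)) := fun s => Real.sqrt_pos.2 (hV' s)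
  have h0 : 0 ≤ PS 0 := PS.2.1 0
  have h1 : 0 ≤ PS 1 := PS.2.1 1
  have h01 : PS 0 + PS 1 = 1 := by rw [← Fin.sum_univ_two fun s => PS s]; exact PS.2.2
  simp_rw [hdisp, ← hI]
  refine ⟨fun hC => ?_, fun hC hε => ?_, fun hC hε => ?_⟩
  · have hmono := strictMono_gaussianCdf_comb h0 h1 h01 (hsq 0) (hsq 1)
    obtain ⟨l, hl⟩ := exists_gaussianCdf_comb_eq h01 hε0 hε1 (hsq 0) (hsq 1)
    have hG : ∀ a, ∑ s, PS s * stateLimit (mutualInfo P (W s)) (condInfoVariance P (W s))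
        (mutualInfo P (W 0)) a = PS 0 * gaussianCdf (a / √(condInfoVariance P (W 0))) +
          PS 1 * gaussianCdf (a / √(condInfoVariance P (W 1))) := fun a => by
      simp [Fin.sum_univ_two, stateLimit, hC]
    have hrate : HasSecondOrderRate W PS ε (mutualInfo P (W 0)) (l : EReal) := by
      refine hasSecondOrderRate_of_forall_lt PS hstrict hV' hε0 hε1 (fun a ha => ?_)
        fun a ha => ?_
      · rw [hG, ← hl]; exact hmono (EReal.coe_lt_coe_iff.1 ha)
      · rw [hG, ← hl]; exact hmono (EReal.coe_lt_coe_iff.1 ha)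
    refine ⟨epsCapacity_eq_of_hasSecondOrderRate hrate, l, fun l' => ⟨fun h => ?_, ?_⟩, hrate⟩
    · exact hmono.injective (h.trans hl.symm)
    · rintro rfl; exact hl
  · have hp : 0 < PS 0 := hε0.trans hε
    obtain ⟨y, hy⟩ := exists_gaussianCdf_eq (div_pos hε0 hp) ((div_lt_one hp).2 hε)
    -- The better channel contributes 0 at the first-order coefficient of the worse one.
    have hG : ∀ a, ∑ s, PS s * stateLimit (mutualInfo P (W s)) (condInfoVariance P (W s))
        (mutualInfo P (W 0)) a = PS 0 * gaussianCdf (a / √(condInfoVariance P (W 0))) :=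
      fun a => by simp [Fin.sum_univ_two, stateLimit, hC.not_gt, hC.ne']
    have hεy : ε = PS 0 * gaussianCdf y := by rw [hy]; field_simp
    have hrate : HasSecondOrderRate W PS ε (mutualInfo P (W 0))
        ((√(condInfoVariance P (W 0)) * y : ℝ) : EReal) := by
      refine hasSecondOrderRate_of_forall_lt PS hstrict hV' hε0 hε1 (fun a ha => ?_)
        fun a ha => ?_
      · rw [hG, hεy]
        refine mul_lt_mul_of_pos_left (strictMono_gaussianCdf ?_) hp
        rw [div_lt_iff₀ (hsq 0), mul_comm]
        exact EReal.coe_lt_coe_iff.1 ha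
      · rw [hG]
        conv_lhs => rw [hεy]
        refine mul_lt_mul_of_pos_left (strictMono_gaussianCdf ?_) hp
        rw [lt_div_iff₀ (hsq 0), mul_comm]
        exact EReal.coe_lt_coe_iff.1 ha
    refine ⟨epsCapacity_eq_of_hasSecondOrderRate hrate, ?_⟩
    rw [← hy, gaussianCdfInv_gaussianCdf, ← EReal.coe_mul]
    exact hrate
  · have hp : 0 < PS 1 := by linarith
    -- At the coefficient of the better channel the worse one contributes its full weight π₀ for
    -- every a.
    have hG : ∀ a, ∑ s, PS s * stateLimit (mutualInfo P (W s)) (condInfoVariance P (W s))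
        (mutualInfo P (W 1)) a = PS 0 + PS 1 * gaussianCdf (a / √(condInfoVariance P (W 1))) :=
      fun a => by simp [Fin.sum_univ_two, stateLimit, hC]
    -- When ε = π₀, the averaged limit exceeds ε at every real a, since Φ is positive; no real a
    -- lies below -∞, so the other side is empty.
    have hbot : PS 0 = ε → HasSecondOrderRate W PS ε (mutualInfo P (W 1)) ⊥ := fun heq => by
      refine hasSecondOrderRate_of_forall_lt PS hstrict hV' hε0 hε1
        (fun a ha => absurd ha not_lt_bot) fun a _ => ?_
      rw [hG, heq]
      exact lt_add_of_pos_right _ (mul_pos hp (gaussianCdf_pos _))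
    rcases hε.eq_or_lt with heq | hlt
    · refine ⟨fun h => absurd heq h.ne, ?_, hbot⟩
      rw [heq, sub_self, zero_div, gaussianCdfInv_zero, EReal.coe_mul_bot_of_pos (hsq 1)]
      exact hbot heq
    · obtain ⟨y, hy⟩ := exists_gaussianCdf_eq (div_pos (sub_pos.2 hlt) hp)
        ((div_lt_one hp).2 (by linarith))
      have hεy : ε = PS 0 + PS 1 * gaussianCdf y := by rw [hy]; field_simp; ring
      have hrate : HasSecondOrderRate W PS ε (mutualInfo P (W 1))
          ((√(condInfoVariance P (W 1)) * y : ℝ) : EReal) := by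
        refine hasSecondOrderRate_of_forall_lt PS hstrict hV' hε0 hε1 (fun a ha => ?_)
          fun a ha => ?_
        · rw [hG]
          conv_rhs => rw [hεy]
          refine add_lt_add_right (mul_lt_mul_of_pos_left (strictMono_gaussianCdf ?_) hp) _
          rw [div_lt_iff₀ (hsq 1), mul_comm]
          exact EReal.coe_lt_coe_iff.1 ha
        · rw [hG]
          conv_lhs => rw [hεy]
          refine add_lt_add_right (mul_lt_mul_of_pos_left (strictMono_gaussianCdf ?_) hp) _
          rw [lt_div_iff₀ (hsq 1), mul_comm]
          exact EReal.coe_lt_coe_iff.1 ha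
      refine ⟨fun _ => epsCapacity_eq_of_hasSecondOrderRate hrate, ?_, hbot⟩
      rw [← hy, gaussianCdfInv_gaussianCdf, ← EReal.coe_mul]
      exact hrate
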